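/- **Theorem 1.1.** Let $\mathbb T=\mathbb R/\mathbb Z$, let $\alpha\in\mathbb R\setminus\mathbb Q$, let $A\in GL(2,\mathbb Z)$ be hyperbolic (no complex eigenvalue of modulus $1$), let $h=(h_1,h_2)^{T}:\mathbb T\to\mathbb T^2$ be continuous, and let $$\varphi:\mathbb T\times\mathbb T^2\to\mathbb T\times\mathbb T^2,\qquad \varphi(\omega,x)=(\omega+\alpha,\;Ax+h(\omega)).$$ For integers $n,m\ge 1$, a *$\varphi^n$-invariant torus of degree $m$* is a set of the form $$\mathcal T=\{(\omega \bmod 1,\;g(\omega+i)) : \omega\in\mathbb R,\ 0\le i\le m-1\}\subset\mathbb T\times\mathbb T^2,$$ where $g:\mathbb R\to\mathbb T^2$ is continuous and satisfies, for all $\omega\in\mathbb R$: $g(\omega)=g(\omega+km)$ for every $k\in\mathbb Z$; $\varphi^n(\omega \bmod 1,\,g(\omega))=(\omega+n\alpha \bmod 1,\,g(\omega+n\alpha))$; and the points $g(\omega),g(\omega+1),\dots,g(\omega+m-1)$ are pairwise distinct. Let $\mathcal G(\varphi)$ be the collection of all $\varphi^n$-invariant tori of degree $m'$, over all $n,m'\ge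 1$, and let $\mathcal G(\varphi;n,m)$ be the collection of all sets that are a $\varphi^k$-invariant torus of degree $m$ for some $1\le k\le n$. Let $\deg(h_i)\in\mathbb Z$ denote the degree of the continuous map $h_i:\mathbb T\to\mathbb T$, and let $m$ be the smallest positive integer such that $$m\,(I-A)^{-1}\begin{pmatrix}\deg(h_1)\\ \deg(h_2)\end{pmatrix}\in\mathbb Z^2 .$$ Then 1. $\mathcal G(\varphi)=\bigcup_{n\ge 1}\mathcal G(\varphi;n,m)$, that is, every invariant torus of $\varphi$ has degree $m$; 2. $\#\,\mathcal G(\varphi;n,m)<\infty$ for every $n\ge 1$; 3. $\displaystyle\lim_{n\to\infty}\frac1n\log\#\,\mathcal G(\varphi;n,m)=h_{\mathrm{top}}(\varphi)$, where $h_{\mathrm{top}}$ is topological entropy. -/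

import Mathlib

noncomputable section

/-- The circle `ℝ / ℤ`. -/
abbrev Circle1 : Type := UnitAddCircle

/-- The two-dimensional torus `ℝ² / ℤ²`, as the product of two circles. -/
abbrev Torus2 : Type := Fin 2 → UnitAddCircle

/-! ### Degree of a continuous self-map of the circle -/

/-- `f` has degree `d`: some (equivalently, every) continuous lift `F : ℝ → ℝ` of `f`
satisfies `F (t + 1) = F t + d`. -/
def HasCircleDegree (f : C(Circle1, Circle1)) (d : ℤ) : Prop :=
  ∃ F : C(ℝ, ℝ), (∀ t : ℝ, ((F t : ℝ) : Circle1) = f (t : Circle1)) ∧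
    ∀ t : ℝ, F (t + 1) = F t + d

theorem eq_of_continuous_of_coe_eq_zero (D : ℝ → ℝ) (hD : Continuous D)
    (h : ∀ t, ((D t : ℝ) : Circle1) = 0) (s t : ℝ) : D s = D t := by
  have hmem : ∀ x, D x ∈ (Set.range ((↑) : ℤ → ℝ)) := by
    intro x
    obtain ⟨n, hn⟩ := (AddCircle.coe_eq_zero_iff (1 : ℝ)).1 (h x)
    exact ⟨n, by simpa using hn⟩
  have hdisc : IsDiscrete (Set.range ((↑) : ℤ → ℝ)) :=
    ⟨(Int.isClosedEmbedding_coe_real.isEmbedding.toHomeomorph.symm.isEmbedding).discreteTopology⟩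
  exact isPreconnected_univ.constant_of_mapsTo hdisc hD.continuousOn (fun x _ => hmem x)
    (Set.mem_univ s) (Set.mem_univ t)

/-- Every continuous self-map of the circle has a degree. -/
theorem exists_hasCircleDegree (f : C(Circle1, Circle1)) : ∃ d : ℤ, HasCircleDegree f d := by
  obtain ⟨x₀, hx₀⟩ := QuotientAddGroup.mk_surjective (f ((0 : ℝ) : Circle1))
  have hcov : IsCoveringMap ((↑) : ℝ → AddCircle (1 : ℝ)) := AddCircle.isCoveringMap_coe 1
  obtain ⟨F, ⟨-, hF⟩, -⟩ := hcov.existsUnique_continuousMap_lifts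
    (f.comp ⟨((↑) : ℝ → Circle1), AddCircle.continuous_mk' 1⟩) 0 x₀ hx₀
  have hF' : ∀ t : ℝ, ((F t : ℝ) : Circle1) = f (t : Circle1) := fun t => congrFun hF t
  have hz : ∀ t : ℝ, ((F (t + 1) - F t : ℝ) : Circle1) = 0 := by
    intro t
    rw [AddCircle.coe_sub, hF', hF', AddCircle.coe_add_period, sub_self]
  obtain ⟨d, hd⟩ := (AddCircle.coe_eq_zero_iff (1 : ℝ)).1 (hz 0)
  refine ⟨d, F, hF', fun t => ?_⟩
  have := eq_of_continuous_of_coe_eq_zero (fun t => F (t + 1) - F t) (by fun_prop) hz t 0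
  simp only [zsmul_eq_mul, mul_one] at hd this
  linarith

/-- The degree is unique. -/
theorem HasCircleDegree.unique {f : C(Circle1, Circle1)} {d e : ℤ}
    (hd : HasCircleDegree f d) (he : HasCircleDegree f e) : d = e := by
  obtain ⟨F, hF, hF1⟩ := hd
  obtain ⟨G, hG, hG1⟩ := he
  have := eq_of_continuous_of_coe_eq_zero (fun t => F t - G t) (by fun_prop)
    (fun t => by rw [AddCircle.coe_sub, hF, hG, sub_self]) (0 + 1) 0
  simp only [hF1, hG1] at this
  have h2 : (d : ℝ) = e := by linarith
  exact_mod_cast h2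

/-- The degree of a continuous self-map of the circle. -/
def circleDegree (f : C(Circle1, Circle1)) : ℤ := (exists_hasCircleDegree f).choose

theorem hasCircleDegree_circleDegree (f : C(Circle1, Circle1)) :
    HasCircleDegree f (circleDegree f) := (exists_hasCircleDegree f).choose_spec

/-- The `i`-th component of a continuous map from the circle to the torus. -/
def torusComponent (h : C(Circle1, Torus2)) (i : Fin 2) : C(Circle1, Circle1) :=
  ⟨fun ω => h ω i, (continuous_apply i).comp h.continuous⟩

/-- The vector `(deg h₁, deg h₂)` of degrees of the components. -/
def degreeVector (h : C(Circle1, Torus2)) (i : Fin 2) : ℤ :=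
  circleDegree (torusComponent h i)

/-! ### The quasi-periodically forced affine Anosov maps -/

/-- An invertible integer matrix is hyperbolic if it has no complex eigenvalue of modulus one. -/
def IsHyperbolicMatrix (A : Matrix.GeneralLinearGroup (Fin 2) ℤ) : Prop :=
  ∀ z ∈ spectrum ℂ ((A : Matrix (Fin 2) (Fin 2) ℤ).map ((↑) : ℤ → ℂ)), ‖z‖ ≠ 1

/-- The linear action `x ↦ A x` of an integer matrix on the torus. -/
def toralAction (A : Matrix.GeneralLinearGroup (Fin 2) ℤ) (x : Torus2) : Torus2 :=
  fun i => ∑ j, (A : Matrix (Fin 2) (Fin 2) ℤ) i j • x j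

/-- The map `φ (ω, x) = (ω + α, A x + h ω)`. -/
def forcedAffineMap (α : ℝ) (A : Matrix.GeneralLinearGroup (Fin 2) ℤ) (h : C(Circle1, Torus2)) :
    Circle1 × Torus2 → Circle1 × Torus2 :=
  fun p => (p.1 + (α : Circle1), toralAction A p.2 + h p.1)

/-! ### Invariant tori -/

/-- The graph of the multivalued map `ω ↦ {g ω, g (ω + 1), …, g (ω + m - 1)}` from the circle to
the torus, where `g` is defined on `ℝ`. -/
def multiGraph (m : ℕ) (g : ℝ → Torus2) : Set (Circle1 × Torus2) :=
  {p | ∃ ω : ℝ, (ω : Circle1) = p.1 ∧ ∃ i : ℕ, i < m ∧ g (ω + i) = p.2}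

/-- `𝒯` is a `φ ^ n`-invariant torus of degree `m`, for a map `φ` that covers the rotation
of the circle by `α`. -/
def IsInvariantTorus (α : ℝ) (φ : Circle1 × Torus2 → Circle1 × Torus2) (n m : ℕ)
    (𝒯 : Set (Circle1 × Torus2)) : Prop :=
  0 < n ∧ 0 < m ∧ ∃ g : ℝ → Torus2, Continuous g ∧
    (∀ (ω : ℝ) (k : ℤ), g ω = g (ω + k * m)) ∧
    (∀ ω : ℝ, φ^[n] ((ω : Circle1), g ω) = (((ω + n * α : ℝ) : Circle1), g (ω + n * α))) ∧
    (∀ ω : ℝ, ∀ i < m, ∀ j < m, i ≠ j → g (ω + (i : ℕ)) ≠ g (ω + (j : ℕ))) ∧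
    𝒯 = multiGraph m g

/-- The collection `𝒢(φ)` of all invariant tori, of any positive period and any degree. -/
def invariantTori (α : ℝ) (φ : Circle1 × Torus2 → Circle1 × Torus2) :
    Set (Set (Circle1 × Torus2)) :=
  {𝒯 | ∃ n m : ℕ, IsInvariantTorus α φ n m 𝒯}

/-- The collection `𝒢(φ; n, m)` of all `φ ^ k`-invariant tori of degree `m`, with `1 ≤ k ≤ n`. -/
def invariantToriUpTo (α : ℝ) (φ : Circle1 × Torus2 → Circle1 × Torus2) (n m : ℕ) :
    Set (Set (Circle1 × Torus2)) :=
  {𝒯 | ∃ k : ℕ, k ≤ n ∧ IsInvariantTorus α φ k m 𝒯}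

/-- Topological entropy of a self-map of a compact uniform space, as an extended real number
(Bowen's definition through spanning sets). -/
def topEntropy {X : Type*} [UniformSpace X] (T : X → X) : EReal :=
  Dynamics.coverEntropy T Set.univ

/-- `m` is a positive integer with `m • (I - A)⁻¹ d ∈ ℤ²`. -/
def IsAdmissibleDegree (A : Matrix.GeneralLinearGroup (Fin 2) ℤ) (d : Fin 2 → ℤ) (m : ℕ) : Prop :=
  0 < m ∧ ∃ v : Fin 2 → ℤ,
    (m : ℚ) • ((1 - (A : Matrix (Fin 2) (Fin 2) ℤ).map ((↑) : ℤ → ℚ))⁻¹).mulVec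
      (fun i => (d i : ℚ)) = fun i => (v i : ℚ)

end

/-! Fix a lift of `h` and put `c = (I - A)⁻¹ d`, where `d` is the degree vector. Looking for an
invariant curve over the universal cover of the base in the form `g ω = ω c + P ω` with `P`
periodic, the linear growth cancels because `A c + d = c`. What remains is a twisted cohomological
equation for `P`, which hyperbolicity solves by a geometric series in each eigendirection. The
resulting `g` satisfies `g (ω + 1) = g ω + c` on the torus, and the order of `c` there is exactly
`m`.

In the coordinates `(ω, q) ↦ (ω, g ω + q)` the map is the translation by `α` times the toral
automorphism `A` (`iterate_forcedAffineMap`). The difference between any invariant torus and `g` is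
a periodic curve equivariant under a power of `A`. Its lift can only satisfy a homogeneous
hyperbolic equation boundedly if the curve is constant (`IsEigencoords.eq_of_equivariant`). So the
invariant tori are the translates `g + q` by periodic points `q` of `A`, and all have degree `m`
(`isInvariantTorus_iff`).

Counting tori thus becomes counting periodic points. There are `|det (A ^ n - 1)|` points with `A ^
n q = q`, which is comparable to `|l 0| ^ n` for the expanding eigenvalue `l 0`; at most `m` of them
give the same torus. The growth rate is therefore `log |l 0|`. The same number is the entropy:
periodic points are separated (`le_topEntropy`), and boxes in eigencoordinates, refined only in the
expanding direction, cover the space (`topEntropy_le`). -/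

open Matrix

/-! ### Eigenvalues and eigencoordinates of a hyperbolic matrix. -/

/-- The real matrix underlying an integer matrix. -/
abbrev realMatrix (A : Matrix.GeneralLinearGroup (Fin 2) ℤ) : Matrix (Fin 2) (Fin 2) ℝ :=
  (A : Matrix (Fin 2) (Fin 2) ℤ).map ((↑) : ℤ → ℝ)

theorem norm_ne_one_of_isRoot {A : Matrix.GeneralLinearGroup (Fin 2) ℤ}
    (hA : IsHyperbolicMatrix A) (z : ℂ)
    (hz : z ^ 2 - ((A.1 0 0 : ℂ) + A.1 1 1) * z
      + ((A.1 0 0 : ℂ) * A.1 1 1 - (A.1 0 1 : ℂ) * A.1 1 0) = 0) : ‖z‖ ≠ 1 := by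
  apply hA
  rw [spectrum.mem_iff, Matrix.isUnit_iff_isUnit_det]
  have : (algebraMap ℂ (Matrix (Fin 2) (Fin 2) ℂ) z
      - (A : Matrix (Fin 2) (Fin 2) ℤ).map ((↑) : ℤ → ℂ)).det = 0 := by
    rw [Matrix.det_fin_two]
    simp only [Matrix.algebraMap_matrix_apply, Matrix.sub_apply, Matrix.map_apply]
    simp
    linear_combination hz
  rw [this]
  simp

theorem abs_det_eq_one (A : Matrix.GeneralLinearGroup (Fin 2) ℤ) :
    A.1 0 0 * A.1 1 1 - A.1 0 1 * A.1 1 0 = 1 ∨ A.1 0 0 * A.1 1 1 - A.1 0 1 * A.1 1 0 = -1 := by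
  have := (Matrix.isUnit_iff_isUnit_det _).1 A.isUnit
  rw [Matrix.det_fin_two] at this
  exact Int.isUnit_iff.1 this

theorem norm_ne_one_of_isRoot_real {A : Matrix.GeneralLinearGroup (Fin 2) ℤ}
    (hA : IsHyperbolicMatrix A) (x : ℝ)
    (hx : x ^ 2 - ((A.1 0 0 : ℝ) + A.1 1 1) * x
      + ((A.1 0 0 : ℝ) * A.1 1 1 - (A.1 0 1 : ℝ) * A.1 1 0) = 0) : |x| ≠ 1 := by
  have := norm_ne_one_of_isRoot hA (x : ℂ) (by exact_mod_cast hx)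
  rwa [Complex.norm_real] at this

/-- Otherwise `A` is triangular and its diagonal entries are eigenvalues that are units of `ℤ`,
hence of modulus one. -/
theorem lower_left_ne_zero {A : Matrix.GeneralLinearGroup (Fin 2) ℤ}
    (hA : IsHyperbolicMatrix A) : A.1 1 0 ≠ 0 := by
  intro hc
  have h1 := norm_ne_one_of_isRoot_real hA (A.1 0 0) (by rw [hc]; push_cast; ring)
  have h2 : IsUnit (A.1 0 0) := by
    have := abs_det_eq_one A
    rw [hc, mul_zero, sub_zero] at this
    exact isUnit_of_mul_isUnit_left (Int.isUnit_iff.2 this)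
  rcases Int.isUnit_iff.1 h2 with h | h <;> rw [h] at h1 <;> simp at h1

/-- Once the discriminant is positive, the two real roots have product `±1` and neither has modulus
one, so they lie on opposite sides of the unit circle. -/
theorem exists_real_eigenvalues {A : Matrix.GeneralLinearGroup (Fin 2) ℤ}
    (hA : IsHyperbolicMatrix A) : ∃ l u : ℝ, 1 < |l| ∧ |u| < 1 ∧ u ≠ 0 ∧
      l + u = A.1 0 0 + A.1 1 1 ∧ l * u = A.1 0 0 * A.1 1 1 - A.1 0 1 * A.1 1 0 := by
  obtain ⟨t, ht⟩ : ∃ t : ℝ, t = A.1 0 0 + A.1 1 1 := ⟨_, rfl⟩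
  obtain ⟨ε, hε⟩ : ∃ ε : ℝ, ε = A.1 0 0 * A.1 1 1 - A.1 0 1 * A.1 1 0 := ⟨_, rfl⟩
  have hε1 : |ε| = 1 := by
    rw [hε]
    rcases abs_det_eq_one A with h | h
    · have : (A.1 0 0 * A.1 1 1 - A.1 0 1 * A.1 1 0 : ℝ) = 1 := by exact_mod_cast h
      rw [this, abs_one]
    · have : (A.1 0 0 * A.1 1 1 - A.1 0 1 * A.1 1 0 : ℝ) = -1 := by exact_mod_cast h
      rw [this, abs_neg, abs_one]
  have hroot := norm_ne_one_of_isRoot_real hA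
  rw [← ht, ← hε] at hroot
  rw [← ht, ← hε]
  have hD : 0 < t ^ 2 - 4 * ε := by
    by_contra! hD
    -- A nonpositive discriminant forces determinant `1`; the roots are then `(t ± i s) / 2`, whose
    -- squared modulus is the determinant.
    have hε' : ε = 1 := by
      rcases abs_eq (zero_le_one' ℝ) |>.1 hε1 with h | h
      · exact h
      · nlinarith [sq_nonneg t]
    set s := Real.sqrt (4 * ε - t ^ 2)
    have hs : s ^ 2 = 4 * ε - t ^ 2 := Real.sq_sqrt (by linarith)
    have hsC : (s : ℂ) ^ 2 = 4 * ε - t ^ 2 := by exact_mod_cast hs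
    have h1 := norm_ne_one_of_isRoot hA (⟨t / 2, s / 2⟩ : ℂ) (by
      have e1 : ((A.1 0 0 : ℂ) + A.1 1 1) = (t : ℂ) := by rw [ht]; push_cast; rfl
      have e2 : ((A.1 0 0 : ℂ) * A.1 1 1 - (A.1 0 1 : ℂ) * A.1 1 0) = (ε : ℂ) := by
        rw [hε]; push_cast; rfl
      rw [e1, e2, Complex.mk_eq_add_mul_I]
      push_cast
      linear_combination (-1 / 4 : ℂ) * hsC + (s : ℂ) ^ 2 / 4 * Complex.I_sq)
    apply h1
    rw [← sq_eq_sq₀ (norm_nonneg _) zero_le_one, ← Complex.normSq_eq_norm_sq, Complex.normSq_mk]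
    nlinarith
  set s := Real.sqrt (t ^ 2 - 4 * ε)
  have hs : s ^ 2 = t ^ 2 - 4 * ε := Real.sq_sqrt hD.le
  have h1 := hroot ((t + s) / 2) (by linear_combination hs / 4)
  have h2 := hroot ((t - s) / 2) (by linear_combination hs / 4)
  have h3 : (t + s) / 2 * ((t - s) / 2) = ε := by linear_combination -hs / 4
  have h4 : |(t + s) / 2| * |(t - s) / 2| = 1 := by rw [← abs_mul, h3, hε1]
  rcases lt_or_gt_of_ne h1 with h | h
  · refine ⟨(t - s) / 2, (t + s) / 2, ?_, h, ?_, by ring, by rw [mul_comm, h3]⟩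
    · by_contra! h'
      nlinarith [abs_nonneg ((t + s) / 2), abs_nonneg ((t - s) / 2)]
    · intro h0; rw [h0] at h4; simp at h4
  · refine ⟨(t + s) / 2, (t - s) / 2, h, ?_, ?_, by ring, h3⟩
    · by_contra! h'
      nlinarith [abs_nonneg ((t + s) / 2), abs_nonneg ((t - s) / 2)]
    · intro h0; rw [h0] at h4; simp at h4

/-- `e` are linear coordinates on the plane diagonalizing `A`, with eigenvalue `l 0` expanding and
`l 1` contracting. -/
structure IsEigencoords (A : Matrix.GeneralLinearGroup (Fin 2) ℤ)
    (e : (Fin 2 → ℝ) ≃L[ℝ] (Fin 2 → ℝ)) (l : Fin 2 → ℝ) : Prop where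
  map_mulVec : ∀ x i, e (realMatrix A *ᵥ x) i = l i * e x i
  expanding : 1 < |l 0|
  contracting : |l 1| < 1
  ne_zero : l 1 ≠ 0

theorem exists_eigencoords {A : Matrix.GeneralLinearGroup (Fin 2) ℤ}
    (hA : IsHyperbolicMatrix A) : ∃ e l, IsEigencoords A e l := by
  obtain ⟨l, u, hl, hu, hu0, hadd, hmul⟩ := exists_real_eigenvalues hA
  have hc : (A.1 1 0 : ℝ) ≠ 0 := by exact_mod_cast lower_left_ne_zero hA
  have hne : u - l ≠ 0 := by
    intro h
    rw [sub_eq_zero.1 h] at hu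
    linarith
  -- The rows are left eigenvectors of `A`. They are independent because the lower left entry is
  -- nonzero and the eigenvalues differ.
  let L : Matrix (Fin 2) (Fin 2) ℝ := !![(A.1 1 0 : ℝ), l - A.1 0 0; (A.1 1 0 : ℝ), u - A.1 0 0]
  have hL : IsUnit L.det := by
    rw [isUnit_iff_ne_zero, Matrix.det_fin_two_of]
    have : (A.1 1 0 : ℝ) * (u - A.1 0 0) - (l - A.1 0 0) * A.1 1 0 = A.1 1 0 * (u - l) := by ring
    rw [this]
    exact mul_ne_zero hc hne
  refine ⟨(Matrix.toLinearEquiv' L (Matrix.invertibleOfIsUnitDet L hL)).toContinuousLinearEquiv,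
    ![l, u], ?_, by simpa using hl, by simpa using hu, by simpa using hu0⟩
  intro x i
  have key : ∀ y, (Matrix.toLinearEquiv' L
      (Matrix.invertibleOfIsUnitDet L hL)).toContinuousLinearEquiv y = L *ᵥ y := fun y => rfl
  rw [key, key]
  fin_cases i
  · simp [L, Matrix.mulVec, dotProduct, Fin.sum_univ_two]
    linear_combination x 1 * (hmul - l * hadd)
  · simp [L, Matrix.mulVec, dotProduct, Fin.sum_univ_two]
    linear_combination x 1 * (hmul - u * hadd)

namespace IsEigencoords

variable {A : Matrix.GeneralLinearGroup (Fin 2) ℤ} {e : (Fin 2 → ℝ) ≃L[ℝ] (Fin 2 → ℝ)}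
  {l : Fin 2 → ℝ}

theorem map_pow_mulVec (he : IsEigencoords A e l) (n : ℕ) (x : Fin 2 → ℝ) (i : Fin 2) :
    e ((realMatrix A ^ n) *ᵥ x) i = l i ^ n * e x i := by
  induction n with
  | zero => simp
  | succ n ih => rw [pow_succ', ← Matrix.mulVec_mulVec, he.map_mulVec, ih, pow_succ']; ring

theorem eigenvalue_ne_zero (he : IsEigencoords A e l) (i : Fin 2) : l i ≠ 0 := by
  fin_cases i
  · intro h
    have := he.expanding
    simp only [Fin.zero_eta] at h
    rw [h, abs_zero] at this
    linarith
  · exact he.ne_zero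

theorem abs_eigenvalue_ne_one (he : IsEigencoords A e l) (i : Fin 2) : |l i| ≠ 1 := by
  fin_cases i
  · exact he.expanding.ne'
  · exact he.contracting.ne

theorem det_pow_sub_one (he : IsEigencoords A e l) (n : ℕ) :
    (realMatrix A ^ n - 1).det = (l 0 ^ n - 1) * (l 1 ^ n - 1) := by
  have h : (Matrix.toLin' (Matrix.diagonal fun i => l i ^ n - 1)) =
      e.toLinearEquiv.toLinearMap ∘ₗ Matrix.toLin' (realMatrix A ^ n - 1) ∘ₗ
        e.toLinearEquiv.symm.toLinearMap := by
    refine LinearMap.ext fun x => funext fun i => ?_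
    have h2 := he.map_pow_mulVec n (e.symm x) i
    rw [e.apply_symm_apply] at h2
    simp only [Matrix.toLin'_apply, LinearMap.comp_apply, Matrix.mulVec_diagonal]
    change _ = e ((realMatrix A ^ n - 1) *ᵥ e.symm x) i
    rw [Matrix.sub_mulVec, map_sub, Matrix.one_mulVec, e.apply_symm_apply, Pi.sub_apply, h2]
    ring
  have h2 := congrArg LinearMap.det h
  rw [LinearMap.det_conj, LinearMap.det_toLin', LinearMap.det_toLin', Matrix.det_diagonal,
    Fin.prod_univ_two] at h2
  exact h2.symm

theorem det_pow_sub_one_ne_zero (he : IsEigencoords A e l) {n : ℕ} (hn : n ≠ 0) :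
    (realMatrix A ^ n - 1).det ≠ 0 := by
  rw [he.det_pow_sub_one]
  have key : ∀ i, l i ^ n - 1 ≠ 0 := by
    intro i h
    have h1 : |l i| ^ n = 1 := by rw [← abs_pow, sub_eq_zero.1 h, abs_one]
    exact he.abs_eigenvalue_ne_one i ((pow_eq_one_iff_of_nonneg (abs_nonneg _) hn).1 h1)
  exact mul_ne_zero (key 0) (key 1)

theorem eq_zero_of_pow_mulVec_eq (he : IsEigencoords A e l) {n : ℕ} (hn : n ≠ 0)
    {x : Fin 2 → ℝ} (hx : (realMatrix A ^ n) *ᵥ x = x) : x = 0 := by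
  by_contra h0
  refine he.det_pow_sub_one_ne_zero hn (Matrix.exists_mulVec_eq_zero_iff.1 ⟨x, h0, ?_⟩)
  rw [Matrix.sub_mulVec, hx, Matrix.one_mulVec, sub_self]

end IsEigencoords

/-! ### The torus as a quotient of the plane, and the number of periodic points. -/

/-- The projection of the plane onto the torus. -/
def toTorus : (Fin 2 → ℝ) →+ Torus2 where
  toFun x i := (x i : UnitAddCircle)
  map_zero' := rfl
  map_add' _ _ := rfl

@[simp] theorem toTorus_apply (x : Fin 2 → ℝ) (i : Fin 2) : toTorus x i = (x i : UnitAddCircle) :=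
  rfl

theorem continuous_toTorus : Continuous toTorus :=
  continuous_pi fun i => (AddCircle.continuous_mk' 1).comp (continuous_apply i)

theorem toTorus_surjective : Function.Surjective toTorus := by
  intro q
  choose x hx using fun i => QuotientAddGroup.mk_surjective (q i)
  exact ⟨x, funext hx⟩

theorem toTorus_eq_zero_iff {x : Fin 2 → ℝ} :
    toTorus x = 0 ↔ ∃ v : Fin 2 → ℤ, x = fun i => (v i : ℝ) := by
  constructor
  · intro h
    choose v hv using fun i => (AddCircle.coe_eq_zero_iff (1 : ℝ)).1 (congrFun h i)
    exact ⟨v, funext fun i => by rw [← hv i]; simp⟩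
  · rintro ⟨v, rfl⟩
    exact funext fun i => (AddCircle.coe_eq_zero_iff (1 : ℝ)).2 ⟨v i, by simp⟩

theorem norm_toTorus_le (x : Fin 2 → ℝ) : ‖toTorus x‖ ≤ ‖x‖ := by
  refine (pi_norm_le_iff_of_nonneg (norm_nonneg _)).2 fun i => ?_
  refine le_trans ?_ (norm_le_pi_norm x i)
  rw [toTorus_apply, AddCircle.norm_eq]
  simpa using round_le (x i) 0

/-- Every point of the torus has a lift of the same norm. -/
theorem exists_toTorus_eq_norm_eq (q : Torus2) : ∃ x, toTorus x = q ∧ ‖x‖ ≤ ‖q‖ := by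
  obtain ⟨y, rfl⟩ := toTorus_surjective q
  refine ⟨fun i => y i - round (y i), ?_, ?_⟩
  · have : (fun i => y i - round (y i)) = y - fun i => (round (y i) : ℝ) := rfl
    rw [this, map_sub, toTorus_eq_zero_iff.2 ⟨fun i => round (y i), rfl⟩, sub_zero]
  · refine (pi_norm_le_iff_of_nonneg (norm_nonneg _)).2 fun i => ?_
    refine le_trans ?_ (norm_le_pi_norm (toTorus y) i)
    rw [toTorus_apply, AddCircle.norm_eq]
    simp

theorem toralAction_toTorus (A : Matrix.GeneralLinearGroup (Fin 2) ℤ) (x : Fin 2 → ℝ) :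
    toralAction A (toTorus x) = toTorus (realMatrix A *ᵥ x) := by
  funext i
  rw [toTorus_apply, Matrix.mulVec, dotProduct, toralAction, Fin.sum_univ_two, Fin.sum_univ_two,
    AddCircle.coe_add]
  simp only [Matrix.map_apply, ← zsmul_eq_mul, AddCircle.coe_zsmul, toTorus_apply]

theorem iterate_toralAction_toTorus (A : Matrix.GeneralLinearGroup (Fin 2) ℤ) (n : ℕ)
    (x : Fin 2 → ℝ) :
    (toralAction A)^[n] (toTorus x) = toTorus ((realMatrix A ^ n) *ᵥ x) := by
  induction n with
  | zero => simp
  | succ n ih =>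
    rw [Function.iterate_succ_apply', ih, toralAction_toTorus, Matrix.mulVec_mulVec, pow_succ']

theorem iterate_toralAction_add (A : Matrix.GeneralLinearGroup (Fin 2) ℤ) (n : ℕ) (x y : Torus2) :
    (toralAction A)^[n] (x + y) = (toralAction A)^[n] x + (toralAction A)^[n] y := by
  obtain ⟨x, rfl⟩ := toTorus_surjective x
  obtain ⟨y, rfl⟩ := toTorus_surjective y
  rw [← map_add, iterate_toralAction_toTorus, iterate_toralAction_toTorus,
    iterate_toralAction_toTorus, Matrix.mulVec_add, map_add]

theorem toralAction_add (A : Matrix.GeneralLinearGroup (Fin 2) ℤ) (x y : Torus2) :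
    toralAction A (x + y) = toralAction A x + toralAction A y :=
  iterate_toralAction_add A 1 x y

theorem iterate_toralAction_sub (A : Matrix.GeneralLinearGroup (Fin 2) ℤ) (n : ℕ) (x y : Torus2) :
    (toralAction A)^[n] (x - y) = (toralAction A)^[n] x - (toralAction A)^[n] y := by
  rw [eq_sub_iff_add_eq, ← iterate_toralAction_add, sub_add_cancel]

/-- The points of the torus of period `n` under `A`. -/
def periodicSet (A : Matrix.GeneralLinearGroup (Fin 2) ℤ) (n : ℕ) : Set Torus2 :=
  {q | (toralAction A)^[n] q = q}

theorem toTorus_mem_periodicSet {A : Matrix.GeneralLinearGroup (Fin 2) ℤ} {n : ℕ}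
    {x : Fin 2 → ℝ} : toTorus x ∈ periodicSet A n ↔
      ∃ v : Fin 2 → ℤ, (realMatrix A ^ n - 1) *ᵥ x = fun i => (v i : ℝ) := by
  rw [periodicSet, Set.mem_ofPred_eq, iterate_toralAction_toTorus, ← sub_eq_zero, ← map_sub,
    toTorus_eq_zero_iff, Matrix.sub_mulVec, Matrix.one_mulVec]

/-- An integer matrix with nonzero determinant has `|det B|` torsion points. -/
theorem natCard_toralKernel (B : Matrix (Fin 2) (Fin 2) ℤ) (hB : B.det ≠ 0) :
    Nat.card {q : Torus2 | ∃ x, toTorus x = q ∧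
      ∃ v : Fin 2 → ℤ, (B.map ((↑) : ℤ → ℝ)) *ᵥ x = fun i => (v i : ℝ)} = B.det.natAbs := by
  set R : Matrix (Fin 2) (Fin 2) ℝ := B.map ((↑) : ℤ → ℝ) with hR
  have hdet : IsUnit R.det := by
    have : R.det = (B.det : ℝ) := ((Int.castRingHom ℝ).map_det B).symm
    rw [this, isUnit_iff_ne_zero]
    exact_mod_cast hB
  have hcast : ∀ v : Fin 2 → ℤ, (R *ᵥ fun i => (v i : ℝ)) = fun i => ((B *ᵥ v) i : ℝ) := by
    intro v
    funext i
    simp [hR, Matrix.mulVec, dotProduct]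
  -- The points in question are `B⁻¹ ℤ²` modulo `ℤ²`, the image of this homomorphism. Its kernel is
  -- `B ℤ²`, so their number is the index of that lattice in `ℤ²`.
  let f : (Fin 2 → ℤ) →+ Torus2 :=
    { toFun := fun v => toTorus (R⁻¹ *ᵥ fun i => (v i : ℝ))
      map_zero' := by
        have : (fun i => (((0 : Fin 2 → ℤ) i : ℤ) : ℝ)) = 0 := by funext; simp
        rw [this, Matrix.mulVec_zero, map_zero]
      map_add' := fun v w => by
        have : (fun i => (((v + w) i : ℤ) : ℝ)) = (fun i => (v i : ℝ)) + fun i => (w i : ℝ) := by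
          funext; simp
        rw [this, Matrix.mulVec_add, map_add] }
  have hrange : {q : Torus2 | ∃ x, toTorus x = q ∧ ∃ v : Fin 2 → ℤ, R *ᵥ x = fun i => (v i : ℝ)}
      = (f.range : Set Torus2) := by
    ext q
    constructor
    · rintro ⟨x, rfl, v, hv⟩
      refine ⟨v, ?_⟩
      change toTorus (R⁻¹ *ᵥ fun i => (v i : ℝ)) = _
      rw [← hv, Matrix.mulVec_mulVec, Matrix.nonsing_inv_mul _ hdet, Matrix.one_mulVec]
    · rintro ⟨v, rfl⟩
      refine ⟨_, rfl, v, ?_⟩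
      rw [Matrix.mulVec_mulVec, Matrix.mul_nonsing_inv _ hdet, Matrix.one_mulVec]
  have hinj : Function.Injective (Matrix.toLin' B) := by
    rw [← LinearMap.ker_eq_bot, LinearMap.ker_eq_bot']
    intro v hv
    by_contra h0
    exact hB (Matrix.exists_mulVec_eq_zero_iff.1 ⟨v, h0, hv⟩)
  have hker : f.ker = (LinearMap.range (Matrix.toLin' B)).toAddSubgroup := by
    ext v
    rw [AddMonoidHom.mem_ker, Submodule.mem_toAddSubgroup, LinearMap.mem_range]
    change toTorus (R⁻¹ *ᵥ fun i => (v i : ℝ)) = 0 ↔ _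
    rw [toTorus_eq_zero_iff]
    refine exists_congr fun w => ?_
    rw [Matrix.toLin'_apply]
    constructor
    · intro h
      have := congrArg (R *ᵥ ·) h
      simp only [Matrix.mulVec_mulVec, Matrix.mul_nonsing_inv _ hdet, Matrix.one_mulVec,
        hcast] at this
      funext i
      have := congrFun this i
      exact_mod_cast this.symm
    · rintro rfl
      rw [← hcast, Matrix.mulVec_mulVec, Matrix.nonsing_inv_mul _ hdet, Matrix.one_mulVec]
  rw [hrange]
  have h1 : Nat.card f.range = Nat.card ((Fin 2 → ℤ) ⧸ f.ker) :=
    (Nat.card_congr (QuotientAddGroup.quotientKerEquivRange f).toEquiv).symm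
  have h2 := Submodule.natAbs_det_equiv (LinearMap.range (Matrix.toLin' B))
    (LinearEquiv.ofInjective (Matrix.toLin' B) hinj).toAddEquiv
  have h3 : ((LinearMap.range (Matrix.toLin' B)).subtype ∘ₗ AddMonoidHom.toIntLinearMap
      ((LinearEquiv.ofInjective (Matrix.toLin' B) hinj).toAddEquiv :
        (Fin 2 → ℤ) →+ LinearMap.range (Matrix.toLin' B))) = Matrix.toLin' B :=
    LinearMap.ext fun x => rfl
  rw [h3, LinearMap.det_toLin'] at h2
  rw [h2]
  refine h1.trans ?_
  rw [hker]
  rfl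

theorem IsEigencoords.natCard_periodicSet {A : Matrix.GeneralLinearGroup (Fin 2) ℤ}
    {e : (Fin 2 → ℝ) ≃L[ℝ] (Fin 2 → ℝ)} {l : Fin 2 → ℝ} (he : IsEigencoords A e l) {n : ℕ}
    (hn : n ≠ 0) : (Nat.card (periodicSet A n) : ℝ) = |(l 0 ^ n - 1) * (l 1 ^ n - 1)| := by
  have hmap : ((A.1 ^ n - 1 : Matrix (Fin 2) (Fin 2) ℤ).map ((↑) : ℤ → ℝ))
      = realMatrix A ^ n - 1 := by
    change (Int.castRingHom ℝ).mapMatrix (A.1 ^ n - 1) = _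
    rw [map_sub, map_pow, map_one]
    rfl
  have hdet : (((A.1 ^ n - 1 : Matrix (Fin 2) (Fin 2) ℤ).det : ℤ) : ℝ)
      = (realMatrix A ^ n - 1).det := by
    rw [← hmap]
    exact (Int.castRingHom ℝ).map_det _
  have h0 : (A.1 ^ n - 1 : Matrix (Fin 2) (Fin 2) ℤ).det ≠ 0 := by
    intro h
    rw [h] at hdet
    exact he.det_pow_sub_one_ne_zero hn (by rw [← hdet]; simp)
  have h1 := natCard_toralKernel _ h0
  have h2 : periodicSet A n = {q : Torus2 | ∃ x, toTorus x = q ∧ ∃ v : Fin 2 → ℤ,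
      ((A.1 ^ n - 1 : Matrix (Fin 2) (Fin 2) ℤ).map ((↑) : ℤ → ℝ)) *ᵥ x
        = fun i => (v i : ℝ)} := by
    ext q
    constructor
    · intro hq
      obtain ⟨x, rfl⟩ := toTorus_surjective q
      exact ⟨x, rfl, by rw [hmap]; exact toTorus_mem_periodicSet.1 hq⟩
    · rintro ⟨x, rfl, hx⟩
      rw [hmap] at hx
      exact toTorus_mem_periodicSet.2 hx
  rw [h2, h1, Nat.cast_natAbs, Int.cast_abs, hdet, he.det_pow_sub_one]

/-! ### The twisted cohomological equation. -/

theorem exists_bound_of_periodic {f : ℝ → ℝ} (hf : Continuous f) {T : ℝ} (hT : T ≠ 0)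
    (hp : Function.Periodic f T) : ∃ C, ∀ x, |f x| ≤ C := by
  obtain ⟨C, hC⟩ := (hp.isBounded_of_continuous hT hf).exists_norm_le
  exact ⟨C, fun x => hC _ ⟨x, rfl⟩⟩

/-- The expanding case of the twisted cohomological equation over a translation. -/
theorem exists_twisted_primitive_of_expanding {κ : ℝ} (hκ : 1 < |κ|) (α : ℝ) {η : ℝ → ℝ}
    (hη : Continuous η) (hper : Function.Periodic η 1) :
    ∃ p : ℝ → ℝ, Continuous p ∧ Function.Periodic p 1 ∧ ∀ ω, p (ω + α) = κ * p ω + η ω := by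
  obtain ⟨C, hC⟩ := exists_bound_of_periodic hη one_ne_zero hper
  have hκ0 : κ ≠ 0 := by
    rintro rfl
    rw [abs_zero] at hκ
    linarith
  have hsum : Summable fun k : ℕ => |κ|⁻¹ ^ k * C :=
    (summable_geometric_of_lt_one (by positivity) (inv_lt_one_of_one_lt₀ hκ)).mul_right C
  have hbound : ∀ (k : ℕ) (ω : ℝ), ‖κ⁻¹ ^ k * η (ω + k * α)‖ ≤ |κ|⁻¹ ^ k * C := by
    intro k ω
    rw [norm_mul, norm_pow, norm_inv, Real.norm_eq_abs, Real.norm_eq_abs]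
    exact mul_le_mul_of_nonneg_left (hC _) (by positivity)
  -- Obtained by iterating `p ω = κ⁻¹ (p (ω + α) - η ω)`.
  refine ⟨fun ω => -(κ⁻¹ * ∑' k : ℕ, κ⁻¹ ^ k * η (ω + k * α)), ?_, ?_, ?_⟩
  · exact ((continuous_tsum (fun k => by fun_prop) hsum hbound).const_mul _).neg
  · intro ω
    have : ∀ k : ℕ, η (ω + 1 + k * α) = η (ω + k * α) := fun k => by
      rw [add_right_comm, hper]
    simp only [this]
  · intro ω
    have hs : Summable fun k : ℕ => κ⁻¹ ^ k * η (ω + k * α) :=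
      Summable.of_norm_bounded hsum fun k => hbound k ω
    have h1 := hs.tsum_eq_zero_add
    have h2 : ∀ k : ℕ, κ⁻¹ ^ (k + 1) * η (ω + ((k + 1 : ℕ) : ℝ) * α)
        = κ⁻¹ * (κ⁻¹ ^ k * η (ω + α + k * α)) := by
      intro k
      have : ω + ((k + 1 : ℕ) : ℝ) * α = ω + α + k * α := by push_cast; ring
      rw [this]
      ring
    simp only [h2, tsum_mul_left] at h1
    simp only [pow_zero, one_mul, Nat.cast_zero, zero_mul, add_zero] at h1
    simp only [h1]
    field_simp
    ring

theorem exists_twisted_primitive {κ : ℝ} (hκ : |κ| ≠ 1) (hκ0 : κ ≠ 0) (α : ℝ) {η : ℝ → ℝ}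
    (hη : Continuous η) (hper : Function.Periodic η 1) :
    ∃ p : ℝ → ℝ, Continuous p ∧ Function.Periodic p 1 ∧ ∀ ω, p (ω + α) = κ * p ω + η ω := by
  rcases lt_or_gt_of_ne hκ with h | h
  -- For contracting `κ`, solving for `p (ω - α)` in terms of `p ω` gives an equation with
  -- multiplier `κ⁻¹` over the translation by `-α`.
  · obtain ⟨p, hp, hp1, hp2⟩ := exists_twisted_primitive_of_expanding (κ := κ⁻¹) (by
      rw [abs_inv]; exact (one_lt_inv₀ (abs_pos.2 hκ0)).2 h) (-α)
      (η := fun ω => -(κ⁻¹ * η (ω - α))) (by fun_prop) (fun ω => by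
        have : ω + 1 - α = ω - α + 1 := by ring
        simp only [this, hper (ω - α)])
    refine ⟨p, hp, hp1, fun ω => ?_⟩
    have := hp2 (ω + α)
    simp only [add_neg_cancel_right, add_sub_cancel_right] at this
    rw [this]
    field_simp
    ring
  · exact exists_twisted_primitive_of_expanding h α hη hper

/-- The vector-valued twisted cohomological equation for a hyperbolic matrix. -/
theorem IsEigencoords.exists_twisted_primitive {A : Matrix.GeneralLinearGroup (Fin 2) ℤ}
    {e : (Fin 2 → ℝ) ≃L[ℝ] (Fin 2 → ℝ)} {l : Fin 2 → ℝ} (he : IsEigencoords A e l) (α : ℝ)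
    {η : ℝ → Fin 2 → ℝ} (hη : Continuous η) (hper : Function.Periodic η 1) :
    ∃ P : ℝ → Fin 2 → ℝ, Continuous P ∧ Function.Periodic P 1 ∧
      ∀ ω, P (ω + α) = realMatrix A *ᵥ P ω + η ω := by
  have := fun i => _root_.exists_twisted_primitive (he.abs_eigenvalue_ne_one i)
    (he.eigenvalue_ne_zero i) α (η := fun ω => e (η ω) i) (by fun_prop)
    (fun ω => by simp only [hper ω])
  choose p hp hp1 hp2 using this
  refine ⟨fun ω => e.symm fun i => p i ω, by fun_prop, fun ω => ?_, fun ω => ?_⟩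
  · simp only [hp1 _ ω]
  · apply e.injective
    funext i
    rw [map_add, Pi.add_apply, he.map_mulVec, e.apply_symm_apply, e.apply_symm_apply, hp2]

/-- A bounded solution of the homogeneous twisted equation vanishes. -/
theorem eq_zero_of_twisted_of_bounded {κ : ℝ} (hκ : |κ| ≠ 1) (hκ0 : κ ≠ 0) {β C : ℝ} {f : ℝ → ℝ}
    (hf : ∀ ω, f (ω + β) = κ * f ω) (hC : ∀ ω, |f ω| ≤ C) (ω : ℝ) : f ω = 0 := by
  by_contra h0
  have hexp : ∀ {κ β : ℝ}, 1 < |κ| → (∀ ω, f (ω + β) = κ * f ω) → False := by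
    intro κ β hκ hf
    have hpow : ∀ k : ℕ, |f (ω + k * β)| = |κ| ^ k * |f ω| := by
      intro k
      induction k with
      | zero => simp
      | succ k ih =>
        have : ω + ((k + 1 : ℕ) : ℝ) * β = ω + k * β + β := by push_cast; ring
        rw [this, hf, abs_mul, ih, pow_succ']
        ring
    obtain ⟨k, hk⟩ := pow_unbounded_of_one_lt (C / |f ω|) hκ
    rw [div_lt_iff₀ (abs_pos.2 h0), ← hpow] at hk
    exact absurd (hC _) (not_le.2 hk)
  rcases lt_or_gt_of_ne hκ with h | h
  · refine hexp (κ := κ⁻¹) (β := -β) ?_ fun ω => ?_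
    · rw [abs_inv]; exact (one_lt_inv₀ (abs_pos.2 hκ0)).2 h
    · have := hf (ω + -β)
      rw [neg_add_cancel_right] at this
      rw [this]
      field_simp
  · exact hexp h hf

/-! ### Lifts of curves and rigidity of equivariant curves. -/

/-- A continuous loop in the torus lifts to the plane along the real line. -/
theorem exists_lift {u : ℝ → Torus2} (hu : Continuous u) :
    ∃ U : ℝ → Fin 2 → ℝ, Continuous U ∧ ∀ ω, toTorus (U ω) = u ω := by
  have : ∀ i, ∃ F : C(ℝ, ℝ), ∀ t, ((F t : ℝ) : UnitAddCircle) = u t i := by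
    intro i
    obtain ⟨x₀, hx₀⟩ := QuotientAddGroup.mk_surjective (u 0 i)
    obtain ⟨F, ⟨-, hF⟩, -⟩ := (AddCircle.isCoveringMap_coe (1 : ℝ)).existsUnique_continuousMap_lifts
      ⟨fun t => u t i, (continuous_apply i).comp hu⟩ 0 x₀ hx₀
    exact ⟨F, fun t => congrFun hF t⟩
  choose F hF using this
  exact ⟨fun ω i => F i ω, by fun_prop, fun ω => funext fun i => hF i ω⟩

theorem eq_of_continuous_of_toTorus_eq_zero {D : ℝ → Fin 2 → ℝ} (hD : Continuous D)
    (h : ∀ t, toTorus (D t) = 0) (s t : ℝ) : D s = D t :=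
  funext fun i => eq_of_continuous_of_coe_eq_zero (fun t => D t i)
    ((continuous_apply i).comp hD) (fun t => congrFun (h t) i) s t

/-- A continuous periodic curve which is equivariant under a power of a hyperbolic automorphism of
the torus and a translation is constant. -/
theorem IsEigencoords.eq_of_equivariant {A : Matrix.GeneralLinearGroup (Fin 2) ℤ}
    {e : (Fin 2 → ℝ) ≃L[ℝ] (Fin 2 → ℝ)} {l : Fin 2 → ℝ} (he : IsEigencoords A e l) {n : ℕ}
    (hn : n ≠ 0) {β T : ℝ} (hT : T ≠ 0) {u : ℝ → Torus2} (hu : Continuous u)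
    (hper : Function.Periodic u T) (heq : ∀ ω, (toralAction A)^[n] (u ω) = u (ω + β)) (s t : ℝ) :
    u s = u t := by
  obtain ⟨U, hU, hUu⟩ := exists_lift hu
  have h1 := eq_of_continuous_of_toTorus_eq_zero (D := fun ω => U (ω + T) - U ω) (by fun_prop)
    (fun ω => by rw [map_sub, hUu, hUu, hper, sub_self])
  have h2 := eq_of_continuous_of_toTorus_eq_zero
    (D := fun ω => U (ω + β) - (realMatrix A ^ n) *ᵥ U ω)
    (by fun_prop)
    (fun ω => by rw [map_sub, ← iterate_toralAction_toTorus, hUu, hUu, heq, sub_self])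
  -- The lift `U` is periodic and equivariant only up to constant integer vectors. Subtracting two
  -- shifts of `U` removes both constants, leaving a bounded solution of the homogeneous equation.
  have h3 : ∀ ω, U (ω + (s - t)) - U ω = 0 := by
    intro ω
    apply e.injective
    funext i
    rw [map_zero, Pi.zero_apply]
    obtain ⟨C, hC⟩ := exists_bound_of_periodic
      (f := fun ω => e (U (ω + (s - t)) - U ω) i) (by fun_prop) hT (fun ω => by
        have := h1 (ω + (s - t)) ω
        rw [sub_eq_sub_iff_sub_eq_sub] at this
        have h4 : ω + T + (s - t) = ω + (s - t) + T := by ring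
        simp only [h4, this])
    refine eq_zero_of_twisted_of_bounded (κ := l i ^ n) (β := β) ?_
      (pow_ne_zero _ (he.eigenvalue_ne_zero i)) (fun ω => ?_) hC ω
    · rw [abs_pow]
      exact fun h => he.abs_eigenvalue_ne_one i ((pow_eq_one_iff_of_nonneg (abs_nonneg _) hn).1 h)
    · have := h2 (ω + (s - t)) ω
      rw [← he.map_pow_mulVec, Matrix.mulVec_sub]
      have h4 : ω + β + (s - t) = ω + (s - t) + β := by ring
      rw [h4]
      rw [sub_eq_sub_iff_sub_eq_sub] at this
      exact congrArg (fun x => e x i) this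
  have := h3 t
  rw [add_sub_cancel, sub_eq_zero] at this
  rw [← hUu, ← hUu, this]

/-! ### Invariant sections and the classification of invariant tori. -/

/-- `g` is a curve in the torus over the universal cover of the base circle, invariant under the
forced map and with monodromy the translation by `c`. -/
structure IsInvariantSection (α : ℝ) (A : Matrix.GeneralLinearGroup (Fin 2) ℤ)
    (h : C(Circle1, Torus2)) (g : ℝ → Torus2) (c : Torus2) : Prop where
  continuous : Continuous g
  map_eq : ∀ ω : ℝ, toralAction A (g ω) + h ω = g (ω + α)
  map_add_one : ∀ ω : ℝ, g (ω + 1) = g ω + c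

/-- Substituting `ω c + P ω` with `A c = c - d` into the invariance equation leaves `P (ω + α) = A P
ω + (F ω - ω d - α c)`. The bracket is periodic since the lift `F` of `h` gains `d` over a period.
-/
theorem exists_isInvariantSection_of_mulVec_eq {α : ℝ} {A : Matrix.GeneralLinearGroup (Fin 2) ℤ}
    {e : (Fin 2 → ℝ) ≃L[ℝ] (Fin 2 → ℝ)} {l : Fin 2 → ℝ} (he : IsEigencoords A e l)
    (h : C(Circle1, Torus2)) {c : Fin 2 → ℝ}
    (hc : realMatrix A *ᵥ c + (fun i => (degreeVector h i : ℝ)) = c) :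
    ∃ g, IsInvariantSection α A h g (toTorus c) := by
  choose F hF hF1 using fun i => hasCircleDegree_circleDegree (torusComponent h i)
  let d : Fin 2 → ℝ := fun i => (degreeVector h i : ℝ)
  obtain ⟨P, hP, hP1, hP2⟩ := he.exists_twisted_primitive α
    (η := fun ω => (fun i => F i ω) - ω • d - α • c) (by fun_prop) (fun ω => by
      funext i
      simp only [Pi.sub_apply, Pi.smul_apply, smul_eq_mul, hF1, d, degreeVector]
      ring)
  refine ⟨fun ω => toTorus (ω • c + P ω),
    ⟨continuous_toTorus.comp (by fun_prop), fun ω => ?_, fun ω => ?_⟩⟩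
  · have hh : h ω = toTorus (fun i => F i ω) := funext fun i => (hF i ω).symm
    rw [toralAction_toTorus, hh, ← map_add, hP2, Matrix.mulVec_add, Matrix.mulVec_smul]
    have hc' : realMatrix A *ᵥ c = c - d := eq_sub_of_add_eq hc
    rw [hc']
    congr 1
    module
  · rw [hP1, ← map_add]
    congr 1
    module

/-- The vector `c = (I - A)⁻¹ d` is computed over `ℚ`. A multiple `k c` vanishes on the torus
exactly when it is integral, so minimality of `m` says that `m` is the order of `c`. -/
theorem exists_isInvariantSection {α : ℝ} {A : Matrix.GeneralLinearGroup (Fin 2) ℤ}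
    {e : (Fin 2 → ℝ) ≃L[ℝ] (Fin 2 → ℝ)} {l : Fin 2 → ℝ} (he : IsEigencoords A e l)
    {h : C(Circle1, Torus2)} {m : ℕ}
    (hm : IsLeast {k : ℕ | IsAdmissibleDegree A (degreeVector h) k} m) :
    ∃ g c, IsInvariantSection α A h g c ∧ addOrderOf c = m := by
  set Q : Matrix (Fin 2) (Fin 2) ℚ := (A : Matrix (Fin 2) (Fin 2) ℤ).map ((↑) : ℤ → ℚ) with hQ
  set d : Fin 2 → ℚ := fun i => (degreeVector h i : ℚ) with hd
  set cQ : Fin 2 → ℚ := ((1 - Q)⁻¹).mulVec d with hcQ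
  have hcast : (1 - Q).map ((↑) : ℚ → ℝ) = 1 - realMatrix A := by
    change (Rat.castHom ℝ).mapMatrix (1 - Q) = _
    rw [map_sub, map_one]
    congr 1
  have hdet : IsUnit (1 - Q).det := by
    rw [isUnit_iff_ne_zero]
    intro h0
    have h1 : (((1 - Q).det : ℚ) : ℝ) = (1 - realMatrix A).det := by
      rw [← hcast]
      exact (Rat.castHom ℝ).map_det _
    rw [h0, Rat.cast_zero, ← neg_sub, Matrix.det_neg] at h1
    have h2 := he.det_pow_sub_one_ne_zero one_ne_zero
    rw [pow_one] at h2
    exact mul_ne_zero (by simp) h2 h1.symm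
  have hc : (1 - Q) *ᵥ cQ = d := by
    rw [hcQ, Matrix.mulVec_mulVec, Matrix.mul_nonsing_inv _ hdet, Matrix.one_mulVec]
  have hcR : realMatrix A *ᵥ (fun i => (cQ i : ℝ)) + (fun i => (degreeVector h i : ℝ))
      = fun i => (cQ i : ℝ) := by
    funext i
    have h1 := congrArg ((↑) : ℚ → ℝ) (congrFun hc i)
    rw [Matrix.sub_mulVec, Matrix.one_mulVec] at h1
    simp only [Matrix.mulVec, dotProduct, Pi.sub_apply, hQ, hd, Matrix.map_apply] at h1
    push_cast at h1
    simp only [Matrix.mulVec, dotProduct, Pi.add_apply, Matrix.map_apply]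
    linarith
  obtain ⟨g, hg⟩ := exists_isInvariantSection_of_mulVec_eq (α := α) he h hcR
  have hiff : ∀ k : ℕ, 0 < k →
      (k • toTorus (fun i => (cQ i : ℝ)) = 0 ↔ IsAdmissibleDegree A (degreeVector h) k) := by
    intro k hk
    rw [← map_nsmul, toTorus_eq_zero_iff, IsAdmissibleDegree, and_iff_right hk]
    refine exists_congr fun v => ?_
    change _ ↔ (k : ℚ) • cQ = _
    rw [funext_iff, funext_iff]
    refine forall_congr' fun i => ?_
    simp only [Pi.smul_apply, nsmul_eq_mul, smul_eq_mul]
    constructor <;> intro h1 <;> exact_mod_cast h1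
  refine ⟨g, _, hg, (addOrderOf_eq_iff hm.1.1).2 ⟨(hiff m hm.1.1).2 hm.1, fun k hk hk0 h0 => ?_⟩⟩
  exact absurd (hm.2 ((hiff k hk0).1 h0)) (not_le.2 hk)

namespace IsInvariantSection

variable {α : ℝ} {A : Matrix.GeneralLinearGroup (Fin 2) ℤ} {h : C(Circle1, Torus2)}
  {g : ℝ → Torus2} {c : Torus2}

theorem map_add_natCast (hg : IsInvariantSection α A h g c) (ω : ℝ) (k : ℕ) :
    g (ω + k) = g ω + k • c := by
  induction k with
  | zero => simp
  | succ k ih => rw [Nat.cast_succ, ← add_assoc, hg.map_add_one, ih, succ_nsmul, add_assoc]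

theorem map_add_intCast (hg : IsInvariantSection α A h g c) (ω : ℝ) (k : ℤ) :
    g (ω + k) = g ω + k • c := by
  obtain ⟨n, rfl | rfl⟩ := k.eq_nat_or_neg
  · simpa using hg.map_add_natCast ω n
  · have := hg.map_add_natCast (ω + ((-(n : ℤ) : ℤ) : ℝ)) n
    push_cast at this
    rw [neg_add_cancel_right] at this
    push_cast
    rw [this, neg_smul, natCast_zsmul, add_neg_cancel_right]

/-- This is the conjugacy, over the universal cover, that removes the forcing. -/
theorem iterate_forcedAffineMap (hg : IsInvariantSection α A h g c) (n : ℕ) (ω : ℝ) (q : Torus2) :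
    (forcedAffineMap α A h)^[n] ((ω : Circle1), g ω + q)
      = (((ω + n * α : ℝ) : Circle1), g (ω + n * α) + (toralAction A)^[n] q) := by
  induction n with
  | zero => simp
  | succ n ih =>
    have h1 : ω + ((n + 1 : ℕ) : ℝ) * α = ω + n * α + α := by push_cast; ring
    rw [Function.iterate_succ_apply', ih, h1, ← hg.map_eq, Function.iterate_succ_apply',
      forcedAffineMap, toralAction_add, AddCircle.coe_add (1 : ℝ) (ω + n * α) α]
    congr 1
    exact add_right_comm _ _ _

/-- The invariant tori are the translates of the invariant section by periodic points. -/
theorem isInvariantTorus_iff (hg : IsInvariantSection α A h g c)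
    {e : (Fin 2 → ℝ) ≃L[ℝ] (Fin 2 → ℝ)} {l : Fin 2 → ℝ} (he : IsEigencoords A e l) {m : ℕ}
    (hm : 0 < m) (hc : addOrderOf c = m) (n k : ℕ) (𝒯 : Set (Circle1 × Torus2)) :
    IsInvariantTorus α (forcedAffineMap α A h) n k 𝒯 ↔
      0 < n ∧ k = m ∧ ∃ q ∈ periodicSet A n, 𝒯 = multiGraph m fun ω => g ω + q := by
  have hmc : m • c = 0 := hc ▸ addOrderOf_nsmul_eq_zero c
  constructor
  · rintro ⟨hn, hk, g', hg', hper, hinv, hdist, rfl⟩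
    have hk1 : ∀ (ω : ℝ) (j : ℕ), g' (ω + j * k) = g' ω := fun ω j => by
      have := hper ω j
      rw [this]
      push_cast
      rfl
    -- The curve `g` has period `m` because `m • c = 0`, and `g'` has period `k`, so `m * k` is a
    -- common period of the difference.
    have hconst := he.eq_of_equivariant hn.ne' (β := n * α) (T := ((m * k : ℕ) : ℝ))
      (by positivity) (u := fun ω => g' ω - g ω) (hg'.sub hg.continuous)
      (fun ω => by
        simp only
        rw [hg.map_add_natCast, Nat.mul_comm, mul_smul, hmc, smul_zero, add_zero, Nat.mul_comm,
          Nat.cast_mul, hk1])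
      (fun ω => by
        have h1 := hg.iterate_forcedAffineMap n ω (g' ω - g ω)
        rw [add_sub_cancel, hinv] at h1
        exact eq_sub_of_add_eq' (Prod.mk.inj h1).2.symm)
    set q := g' 0 - g 0 with hq
    have hgq : ∀ ω, g' ω = g ω + q := fun ω => by rw [hq, ← hconst ω 0, add_sub_cancel]
    have hqn : (toralAction A)^[n] q = q := by
      have h1 := hg.iterate_forcedAffineMap n 0 q
      rw [← hgq, hinv, hgq] at h1
      exact (add_left_cancel (Prod.mk.inj h1).2).symm
    have hkc : k • c = 0 := by
      have h1 := hk1 0 1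
      rw [Nat.cast_one, one_mul, hgq, hgq, hg.map_add_natCast, add_right_comm] at h1
      exact add_eq_left.1 h1
    -- Periodicity of `g'` gives `m ∣ k`. If `k` exceeded `m`, then `g' 0 = g' m` would contradict
    -- distinctness.
    have hmk : k = m := by
      have h1 : m ∣ k := hc ▸ addOrderOf_dvd_of_nsmul_eq_zero hkc
      by_contra hne
      have h2 : m < k := lt_of_le_of_ne (Nat.le_of_dvd hk h1) (Ne.symm hne)
      refine hdist 0 m h2 0 hk hm.ne' ?_
      rw [hgq, hgq, hg.map_add_natCast, hmc, Nat.cast_zero, add_zero, add_zero]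
    subst hmk
    exact ⟨hn, rfl, q, hqn, by rw [funext hgq]⟩
  · rintro ⟨hn, rfl, q, hq, rfl⟩
    refine ⟨hn, hm, fun ω => g ω + q, hg.continuous.add continuous_const, fun ω j => ?_,
      fun ω => ?_, fun ω i hi j hj hij heq => hij ?_, rfl⟩
    · have h1 := hg.map_add_intCast ω (j * (k : ℤ))
      push_cast at h1
      simp only [h1, mul_smul, natCast_zsmul, hmc, smul_zero, add_zero]
    · rw [hg.iterate_forcedAffineMap, show (toralAction A)^[n] q = q from hq]
    · simp only at heq
      rw [hg.map_add_natCast, hg.map_add_natCast] at heq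
      have h1 : i • c = j • c := add_left_cancel (add_right_cancel heq)
      exact nsmul_injOn_Iio_addOrderOf (by rwa [Set.mem_Iio, hc]) (by rwa [Set.mem_Iio, hc]) h1

/-- Two translates of the section giving the same torus differ by a multiple of the monodromy. -/
theorem exists_eq_add_zsmul_of_multiGraph_eq (hg : IsInvariantSection α A h g c) {m : ℕ}
    (hm : 0 < m) {q q' : Torus2}
    (heq : multiGraph m (fun ω => g ω + q) = multiGraph m (fun ω => g ω + q')) :
    ∃ k : ℤ, q = q' + k • c := by
  -- It suffices to compare the fibres over the base point `0`, whose lifts are the integers.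
  have h1 : (((0 : ℝ) : Circle1), g 0 + q) ∈ multiGraph m (fun ω => g ω + q) :=
    ⟨0, rfl, 0, hm, by simp⟩
  rw [heq] at h1
  obtain ⟨ω, hω, i, -, hi⟩ := h1
  obtain ⟨k, hk⟩ := (AddCircle.coe_eq_zero_iff (1 : ℝ)).1 hω
  simp only [zsmul_eq_mul, mul_one] at hk
  refine ⟨k + i, ?_⟩
  simp only at hi
  have h2 := hg.map_add_intCast 0 (k + i)
  push_cast at h2
  rw [← hk, ← zero_add (k : ℝ), add_assoc, h2, add_assoc] at hi
  rw [← add_left_cancel hi, add_comm]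

end IsInvariantSection

/-! ### Counting periodic points and tori. -/

namespace IsEigencoords

variable {A : Matrix.GeneralLinearGroup (Fin 2) ℤ} {e : (Fin 2 → ℝ) ≃L[ℝ] (Fin 2 → ℝ)}
  {l : Fin 2 → ℝ}

theorem ncard_periodicSet (he : IsEigencoords A e l) {n : ℕ} (hn : n ≠ 0) :
    ((periodicSet A n).ncard : ℝ) = |l 0 ^ n - 1| * |l 1 ^ n - 1| := by
  rw [← abs_mul, ← he.natCard_periodicSet hn, Nat.card_coe_set_eq]

theorem ncard_periodicSet_le (he : IsEigencoords A e l) {n : ℕ} (hn : n ≠ 0) :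
    ((periodicSet A n).ncard : ℝ) ≤ 4 * |l 0| ^ n := by
  have h0 : 1 ≤ |l 0| ^ n := one_le_pow₀ he.expanding.le
  have h1 : |l 1| ^ n ≤ 1 := pow_le_one₀ (abs_nonneg _) he.contracting.le
  have h2 : |l 0 ^ n - 1| ≤ 2 * |l 0| ^ n := by
    refine (abs_sub _ _).trans ?_
    rw [abs_pow, abs_one]
    linarith
  have h3 : |l 1 ^ n - 1| ≤ 2 := by
    refine (abs_sub _ _).trans ?_
    rw [abs_pow, abs_one]
    linarith
  rw [he.ncard_periodicSet hn]
  calc _ ≤ 2 * |l 0| ^ n * 2 := mul_le_mul h2 h3 (abs_nonneg _) (by positivity)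
    _ = _ := by ring

theorem exists_mul_le_ncard_periodicSet (he : IsEigencoords A e l) :
    ∃ a : ℝ, 0 < a ∧ ∀ n : ℕ, n ≠ 0 → a * |l 0| ^ n ≤ (periodicSet A n).ncard := by
  have hl0 : 0 < |l 0| := zero_lt_one.trans he.expanding
  have ha0 : 0 < 1 - |l 0|⁻¹ := sub_pos.2 (inv_lt_one_of_one_lt₀ he.expanding)
  have ha1 : 0 < 1 - |l 1| := sub_pos.2 he.contracting
  refine ⟨(1 - |l 0|⁻¹) * (1 - |l 1|), mul_pos ha0 ha1, fun n hn => ?_⟩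
  have h0 : (1 - |l 0|⁻¹) * |l 0| ^ n ≤ |l 0 ^ n - 1| := by
    have h1 := abs_sub_abs_le_abs_sub (l 0 ^ n) 1
    have h2 : |l 0| ≤ |l 0| ^ n := le_self_pow₀ he.expanding.le hn
    have h3 : 1 ≤ |l 0|⁻¹ * |l 0| ^ n := by
      rw [inv_mul_eq_div, le_div_iff₀ hl0, one_mul]
      exact h2
    rw [abs_pow, abs_one] at h1
    linarith
  have h1 : 1 - |l 1| ≤ |l 1 ^ n - 1| := by
    have h1 := abs_sub_abs_le_abs_sub 1 (l 1 ^ n)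
    have h2 : |l 1| ^ n ≤ |l 1| := pow_le_of_le_one (abs_nonneg _) he.contracting.le hn
    rw [abs_pow, abs_one, abs_sub_comm] at h1
    linarith
  rw [he.ncard_periodicSet hn]
  calc _ = (1 - |l 0|⁻¹) * |l 0| ^ n * (1 - |l 1|) := by ring
    _ ≤ _ := mul_le_mul h0 h1 ha1.le (abs_nonneg _)

theorem finite_periodicSet (he : IsEigencoords A e l) {n : ℕ} (hn : n ≠ 0) :
    (periodicSet A n).Finite := by
  obtain ⟨a, ha, h⟩ := he.exists_mul_le_ncard_periodicSet
  have hl0 : 0 < |l 0| := zero_lt_one.trans he.expanding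
  -- `Set.ncard` is zero on infinite sets, so the positive lower bound already gives finiteness.
  refine Set.finite_of_ncard_pos ?_
  have : (0 : ℝ) < (periodicSet A n).ncard := (by positivity : 0 < a * |l 0| ^ n).trans_le (h n hn)
  exact_mod_cast this

end IsEigencoords

namespace IsInvariantSection

variable {α : ℝ} {A : Matrix.GeneralLinearGroup (Fin 2) ℤ} {h : C(Circle1, Torus2)}
  {g : ℝ → Torus2} {c : Torus2} {e : (Fin 2 → ℝ) ≃L[ℝ] (Fin 2 → ℝ)} {l : Fin 2 → ℝ} {m : ℕ}

theorem invariantToriUpTo_eq (hg : IsInvariantSection α A h g c) (he : IsEigencoords A e l)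
    (hm : 0 < m) (hc : addOrderOf c = m) (n : ℕ) :
    invariantToriUpTo α (forcedAffineMap α A h) n m =
      ⋃ k ∈ Finset.Icc 1 n, (fun q => multiGraph m fun ω => g ω + q) '' periodicSet A k := by
  ext 𝒯
  simp only [invariantToriUpTo, Set.mem_ofPred_eq, hg.isInvariantTorus_iff he hm hc, Set.mem_iUnion,
    Set.mem_image, Finset.mem_Icc, exists_prop]
  constructor
  · rintro ⟨k, hk, hk0, -, q, hq, rfl⟩
    exact ⟨k, ⟨hk0, hk⟩, q, hq, rfl⟩
  · rintro ⟨k, ⟨hk0, hk⟩, q, hq, rfl⟩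
    exact ⟨k, hk, hk0, trivial, q, hq, rfl⟩

theorem finite_invariantToriUpTo (hg : IsInvariantSection α A h g c) (he : IsEigencoords A e l)
    (hm : 0 < m) (hc : addOrderOf c = m) (n : ℕ) :
    (invariantToriUpTo α (forcedAffineMap α A h) n m).Finite := by
  rw [hg.invariantToriUpTo_eq he hm hc]
  refine (Finset.finite_toSet _).biUnion fun k hk => ?_
  exact (he.finite_periodicSet (by rw [Finset.mem_coe, Finset.mem_Icc] at hk; omega)).image _

theorem ncard_invariantToriUpTo_le (hg : IsInvariantSection α A h g c) (he : IsEigencoords A e l)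
    (hm : 0 < m) (hc : addOrderOf c = m) (n : ℕ) :
    ((invariantToriUpTo α (forcedAffineMap α A h) n m).ncard : ℝ) ≤ n * (4 * |l 0| ^ n) := by
  rw [hg.invariantToriUpTo_eq he hm hc]
  refine le_trans (Nat.cast_le.2 (Finset.set_ncard_biUnion_le _ _)) ?_
  rw [Nat.cast_sum]
  refine le_trans (Finset.sum_le_card_nsmul _ _ (4 * |l 0| ^ n) fun k hk => ?_) ?_
  · rw [Finset.mem_Icc] at hk
    have hk0 : k ≠ 0 := by omega
    refine le_trans (Nat.cast_le.2 (Set.ncard_image_le (he.finite_periodicSet hk0))) ?_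
    refine (he.ncard_periodicSet_le hk0).trans ?_
    have := pow_le_pow_right₀ he.expanding.le hk.2
    linarith
  · rw [Nat.card_Icc, add_tsub_cancel_right, nsmul_eq_mul]

/-- Each fibre of the map from periodic points to tori lies in a coset of the subgroup generated by
`c`, which has `m` elements. -/
theorem ncard_periodicSet_le_mul (hg : IsInvariantSection α A h g c) (he : IsEigencoords A e l)
    (hm : 0 < m) (hc : addOrderOf c = m) {n : ℕ} (hn : n ≠ 0) :
    (periodicSet A n).ncard ≤ m * (invariantToriUpTo α (forcedAffineMap α A h) n m).ncard := by
  classical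
  set F : Torus2 → Set (Circle1 × Torus2) := fun q => multiGraph m fun ω => g ω + q with hF
  have hfin := he.finite_periodicSet hn
  have hzfin : (AddSubgroup.zmultiples c : Set Torus2).Finite := by
    refine Set.finite_of_ncard_pos ?_
    rw [← Nat.card_coe_set_eq]
    change 0 < Nat.card (AddSubgroup.zmultiples c)
    rwa [Nat.card_zmultiples, hc]
  have h1 : hfin.toFinset.card ≤ m * (hfin.toFinset.image F).card := by
    refine Finset.card_le_mul_card_image _ _ fun b hb => ?_
    obtain ⟨q', -, rfl⟩ := Finset.mem_image.1 hb
    calc _ ≤ (hzfin.toFinset.image (q' + ·)).card := by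
          refine Finset.card_le_card fun q hq => ?_
          obtain ⟨k, hk⟩ := hg.exists_eq_add_zsmul_of_multiGraph_eq hm (Finset.mem_filter.1 hq).2
          exact Finset.mem_image.2 ⟨k • c, hzfin.mem_toFinset.2 ⟨k, rfl⟩, hk.symm⟩
      _ ≤ hzfin.toFinset.card := Finset.card_image_le
      _ = m := by
          rw [← Set.ncard_eq_toFinset_card _ hzfin, ← Nat.card_coe_set_eq, ← hc]
          exact Nat.card_zmultiples c
  rw [Set.ncard_eq_toFinset_card _ hfin]
  refine h1.trans (Nat.mul_le_mul_left _ ?_)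
  rw [← Set.ncard_coe_finset]
  refine Set.ncard_le_ncard ?_ (hg.finite_invariantToriUpTo he hm hc n)
  rw [hg.invariantToriUpTo_eq he hm hc]
  intro T hT
  obtain ⟨q, hq, rfl⟩ := Finset.mem_image.1 (Finset.mem_coe.1 hT)
  exact Set.mem_biUnion (x := n) (by rw [Finset.coe_Icc, Set.mem_Icc]; omega)
    ⟨q, hfin.mem_toFinset.1 hq, rfl⟩

end IsInvariantSection

/-! ### Exponential growth rates and the lower bound for entropy. -/

/-- A sequence squeezed between `a r ^ n` and `n b r ^ n` grows at the exponential rate `log r`. -/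
theorem tendsto_log_div_of_bounds {a b r : ℝ} (ha : 0 < a) (hb : 0 < b) (hr : 0 < r) {x : ℕ → ℝ}
    (hlo : ∀ n : ℕ, n ≠ 0 → a * r ^ n ≤ x n) (hup : ∀ n : ℕ, x n ≤ n * (b * r ^ n)) :
    Filter.Tendsto (fun n : ℕ => 1 / (n : ℝ) * Real.log (x n)) Filter.atTop
      (nhds (Real.log r)) := by
  have hinv : Filter.Tendsto (fun n : ℕ => 1 / (n : ℝ)) Filter.atTop (nhds 0) :=
    tendsto_one_div_atTop_nhds_zero_nat
  have hlog : Filter.Tendsto (fun n : ℕ => Real.log n / (n : ℝ)) Filter.atTop (nhds 0) :=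
    (Real.isLittleO_log_id_atTop.tendsto_div_nhds_zero).comp tendsto_natCast_atTop_atTop
  have h1 : Filter.Tendsto (fun n : ℕ => 1 / (n : ℝ) * Real.log a + Real.log r) Filter.atTop
      (nhds (Real.log r)) := by
    simpa using (hinv.mul_const (Real.log a)).add_const (Real.log r)
  have h2 : Filter.Tendsto
      (fun n : ℕ => Real.log n / (n : ℝ) + 1 / (n : ℝ) * Real.log b + Real.log r) Filter.atTop
      (nhds (Real.log r)) := by
    simpa using (hlog.add (hinv.mul_const (Real.log b))).add_const (Real.log r)
  refine tendsto_of_tendsto_of_tendsto_of_le_of_le' h1 h2 ?_ ?_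
  · filter_upwards [Filter.eventually_ne_atTop 0] with n hn
    have h3 := Real.log_le_log (by positivity) (hlo n hn)
    rw [Real.log_mul ha.ne' (by positivity), Real.log_pow] at h3
    have hn' : (n : ℝ) ≠ 0 := Nat.cast_ne_zero.2 hn
    calc _ = 1 / (n : ℝ) * (Real.log a + n * Real.log r) := by field_simp
      _ ≤ _ := mul_le_mul_of_nonneg_left h3 (by positivity)
  · filter_upwards [Filter.eventually_ne_atTop 0] with n hn
    have hn' : (n : ℝ) ≠ 0 := Nat.cast_ne_zero.2 hn
    have h3 := Real.log_le_log ((by positivity : 0 < a * r ^ n).trans_le (hlo n hn)) (hup n)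
    rw [Real.log_mul hn' (by positivity), Real.log_mul hb.ne' (by positivity), Real.log_pow] at h3
    calc _ ≤ 1 / (n : ℝ) * (Real.log n + (Real.log b + n * Real.log r)) :=
          mul_le_mul_of_nonneg_left h3 (by positivity)
      _ = _ := by field_simp; ring

/-- If points with the same code stay close for time `n`, there are at most as many elements in a
minimal dynamical cover as there are codes. -/
theorem coverMincard_le_card_of_code {X Y : Type*} [Nonempty X] (T : X → X) (U : SetRel X X)
    (n : ℕ) (code : X → Y) (S : Finset Y) (hS : ∀ x, code x ∈ S)
    (h : ∀ x y, code x = code y → (x, y) ∈ Dynamics.dynEntourage T U n) :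
    Dynamics.coverMincard T Set.univ U n ≤ S.card := by
  classical
  have hcov : Dynamics.IsDynCoverOf T Set.univ U n
      ((S.image (Function.invFun code) : Finset X) : Set X) := by
    intro x _
    -- `Function.invFun` selects one representative for each attained code; its values at the other
    -- codes do no harm.
    refine ⟨Function.invFun code (code x),
      Finset.mem_coe.2 (Finset.mem_image_of_mem _ (hS x)), h _ _ ?_⟩
    exact (Function.invFun_eq ⟨x, rfl⟩).symm
  exact hcov.coverMincard_le_card.trans (Nat.cast_le.2 Finset.card_image_le)

theorem expGrowthSup_le_log_of_le {u : ℕ → ENNReal} {C r : ℝ} (hr : 0 < r)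
    (h : ∀ n, u n ≤ ENNReal.ofReal (C * r ^ n)) :
    ExpGrowth.expGrowthSup u ≤ Real.log r := by
  rw [← ENNReal.log_ofReal_of_pos hr, ← ExpGrowth.expGrowthSup_pow]
  refine ExpGrowth.expGrowthSup_le_of_eventually_le (b := ENNReal.ofReal C) ENNReal.ofReal_ne_top
    (Filter.Eventually.of_forall fun n => ?_)
  rw [← ENNReal.ofReal_pow hr.le, ← ENNReal.ofReal_mul' (by positivity)]
  exact h n

theorem log_le_expGrowthSup_of_le {u : ℕ → ENNReal} {a r : ℝ} (ha : 0 < a) (hr : 0 < r)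
    (h : ∀ n, n ≠ 0 → ENNReal.ofReal (a * r ^ n) ≤ u n) :
    (Real.log r : EReal) ≤ ExpGrowth.expGrowthSup u := by
  rw [← ENNReal.log_ofReal_of_pos hr, ← ExpGrowth.expGrowthSup_pow]
  refine ExpGrowth.expGrowthSup_of_eventually_ge (b := ENNReal.ofReal a)
    (ENNReal.ofReal_pos.2 ha).ne' ?_
  filter_upwards [Filter.eventually_ne_atTop 0] with n hn
  rw [← ENNReal.ofReal_pow hr.le, ← ENNReal.ofReal_mul ha.le]
  exact h n hn

theorem exists_norm_mulVec_le (M : Matrix (Fin 2) (Fin 2) ℝ) :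
    ∃ K : ℝ, 0 ≤ K ∧ ∀ x, ‖M *ᵥ x‖ ≤ K * ‖x‖ :=
  ⟨_, norm_nonneg _, (LinearMap.toContinuousLinearMap (Matrix.mulVecLin M)).le_opNorm⟩

/-- Hyperbolic automorphisms of the torus are expansive along periodic orbits. -/
theorem IsEigencoords.exists_expansive {A : Matrix.GeneralLinearGroup (Fin 2) ℤ}
    {e : (Fin 2 → ℝ) ≃L[ℝ] (Fin 2 → ℝ)} {l : Fin 2 → ℝ} (he : IsEigencoords A e l) :
    ∃ ε : ℝ, 0 < ε ∧ ∀ n : ℕ, n ≠ 0 → ∀ q ∈ periodicSet A n,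
      (∀ k < n, ‖(toralAction A)^[k] q‖ < ε) → q = 0 := by
  obtain ⟨K, hK0, hK⟩ := exists_norm_mulVec_le (realMatrix A)
  -- With this threshold, a short lift of the next orbit point differs from `A` times the current
  -- short lift by an integer vector of norm below `1 / (K + 1) + K / (K + 1) = 1`, hence by zero.
  refine ⟨1 / (K + 1), by positivity, fun n hn q hq hsmall => ?_⟩
  choose s hs hs' using exists_toTorus_eq_norm_eq
  have hqn : (toralAction A)^[n] q = q := hq
  have hsm : ∀ k ≤ n, ‖s ((toralAction A)^[k] q)‖ < 1 / (K + 1) := by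
    intro k hk
    rcases hk.lt_or_eq with hk | rfl
    · exact (hs' _).trans_lt (hsmall k hk)
    · rw [hqn]
      exact (hs' _).trans_lt (hsmall 0 (Nat.pos_of_ne_zero hn))
  have hstep : ∀ k < n, s ((toralAction A)^[k + 1] q)
      = realMatrix A *ᵥ s ((toralAction A)^[k] q) := by
    intro k hk
    have h1 : toTorus (s ((toralAction A)^[k + 1] q)
        - realMatrix A *ᵥ s ((toralAction A)^[k] q)) = 0 := by
      rw [map_sub, ← toralAction_toTorus, hs, hs, Function.iterate_succ_apply', sub_self]
    obtain ⟨v, hv⟩ := toTorus_eq_zero_iff.1 h1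
    have h2 : ‖s ((toralAction A)^[k + 1] q)
        - realMatrix A *ᵥ s ((toralAction A)^[k] q)‖ < 1 := by
      refine (norm_sub_le _ _).trans_lt ?_
      have h3 := hsm (k + 1) hk
      have h4 := hK (s ((toralAction A)^[k] q))
      have h5 : K * ‖s ((toralAction A)^[k] q)‖ ≤ K * (1 / (K + 1)) :=
        mul_le_mul_of_nonneg_left (hsm k hk.le).le hK0
      have h6 : 1 / (K + 1) + K * (1 / (K + 1)) = 1 := by field_simp; ring
      linarith
    rw [← sub_eq_zero, hv]
    rw [hv] at h2
    funext i
    have h3 := (norm_le_pi_norm (fun i => (v i : ℝ)) i).trans_lt h2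
    rw [Real.norm_eq_abs] at h3
    have h4 : |v i| < 1 := by exact_mod_cast h3
    rw [Int.abs_lt_one_iff.1 h4]
    simp
  have hpow : ∀ k ≤ n, s ((toralAction A)^[k] q) = (realMatrix A ^ k) *ᵥ s q := by
    intro k
    induction k with
    | zero => intro _; simp
    | succ k ih =>
      intro hk
      rw [hstep k hk, ih (Nat.le_of_succ_le hk), Matrix.mulVec_mulVec, pow_succ']
  -- The short lifts follow the linear orbit and close up after `n` steps, so the initial lift is
  -- fixed by `A ^ n`.
  have h0 := hpow n le_rfl
  rw [hqn] at h0
  rw [← hs q, he.eq_zero_of_pow_mulVec_eq hn h0.symm, map_zero]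

namespace IsInvariantSection

variable {α : ℝ} {A : Matrix.GeneralLinearGroup (Fin 2) ℤ} {h : C(Circle1, Torus2)}
  {g : ℝ → Torus2} {c : Torus2} {e : (Fin 2 → ℝ) ≃L[ℝ] (Fin 2 → ℝ)} {l : Fin 2 → ℝ} {m : ℕ}

/-- Points over the same base point keep the same base coordinate, and `g` cancels in their fibre
difference, which evolves as `A ^ k (q - q')`. Expansiveness therefore separates the points coming
from distinct `q` in `periodicSet A n`. -/
theorem le_topEntropy (hg : IsInvariantSection α A h g c) (he : IsEigencoords A e l) :
    (Real.log |l 0| : EReal) ≤ topEntropy (forcedAffineMap α A h) := by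
  classical
  obtain ⟨ε, hε, hexp⟩ := he.exists_expansive
  obtain ⟨a, ha, hlow⟩ := he.exists_mul_le_ncard_periodicSet
  -- Nets are defined by disjointness of dynamical balls, so half the expansivity constant is
  -- needed: a common point `z` of two balls brings their centres within `ε`.
  refine le_trans ?_ (Dynamics.netEntropyEntourage_le_coverEntropy
    (T := forcedAffineMap α A h) (F := Set.univ) (Metric.dist_mem_uniformity (half_pos hε)))
  refine log_le_expGrowthSup_of_le ha (zero_lt_one.trans he.expanding) fun n hn => ?_
  have hfin := he.finite_periodicSet hn
  have hsep : ∀ q ∈ periodicSet A n, ∀ q' ∈ periodicSet A n, ∀ z,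
      (∀ k < n, dist ((forcedAffineMap α A h)^[k] (((0 : ℝ) : Circle1), g 0 + q))
        ((forcedAffineMap α A h)^[k] z) < ε / 2) →
      (∀ k < n, dist ((forcedAffineMap α A h)^[k] (((0 : ℝ) : Circle1), g 0 + q'))
        ((forcedAffineMap α A h)^[k] z) < ε / 2) → q = q' := by
    intro q hq q' hq' z h1 h2
    refine sub_eq_zero.1 (hexp n hn _ ?_ fun k hk => ?_)
    · rw [periodicSet, Set.mem_ofPred_eq, iterate_toralAction_sub]
      exact congrArg₂ _ hq hq'
    · have h3 := dist_triangle_right ((forcedAffineMap α A h)^[k] (((0 : ℝ) : Circle1), g 0 + q))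
        ((forcedAffineMap α A h)^[k] (((0 : ℝ) : Circle1), g 0 + q'))
        ((forcedAffineMap α A h)^[k] z)
      rw [hg.iterate_forcedAffineMap, hg.iterate_forcedAffineMap] at h3
      have h4 := h1 k hk
      have h5 := h2 k hk
      rw [hg.iterate_forcedAffineMap] at h4 h5
      rw [iterate_toralAction_sub, ← dist_eq_norm]
      refine lt_of_le_of_lt ?_ (lt_of_le_of_lt h3 (by linarith))
      refine le_trans ?_ (le_max_right _ _)
      exact (dist_add_left _ _ _).ge
  set f : Torus2 → Circle1 × Torus2 := fun q => (((0 : ℝ) : Circle1), g 0 + q) with hf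
  have hnet : Dynamics.IsDynNetIn (forcedAffineMap α A h) Set.univ
      {p : (Circle1 × Torus2) × (Circle1 × Torus2) | dist p.1 p.2 < ε / 2} n
      ((hfin.toFinset.image f : Finset (Circle1 × Torus2)) : Set (Circle1 × Torus2)) := by
    refine ⟨Set.subset_univ _, fun x hx y hy hxy => ?_⟩
    obtain ⟨q, hq, rfl⟩ := Finset.mem_image.1 (Finset.mem_coe.1 hx)
    obtain ⟨q', hq', rfl⟩ := Finset.mem_image.1 (Finset.mem_coe.1 hy)
    refine Set.disjoint_left.2 fun z hz hz' => hxy ?_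
    rw [hsep q (hfin.mem_toFinset.1 hq) q' (hfin.mem_toFinset.1 hq') z
      (Dynamics.mem_dynEntourage.1 hz) (Dynamics.mem_dynEntourage.1 hz')]
  have hcard : (hfin.toFinset.image f).card = (periodicSet A n).ncard := by
    rw [Finset.card_image_of_injective, ← Set.ncard_eq_toFinset_card _ hfin]
    intro q q' hqq
    exact add_left_cancel (Prod.mk.inj hqq).2
  have hmax := hnet.card_le_netMaxcard
  rw [hcard] at hmax
  calc ENNReal.ofReal (a * |l 0| ^ n) ≤ ENNReal.ofReal ((periodicSet A n).ncard : ℝ) :=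
        ENNReal.ofReal_le_ofReal (hlow n hn)
    _ = (((periodicSet A n).ncard : ℕ∞) : ENNReal) := by
        rw [ENNReal.ofReal_natCast]
        rfl
    _ ≤ _ := ENat.toENNReal_mono hmax

end IsInvariantSection

/-! ### The upper bound for entropy. -/

theorem norm_coe_circle_le (x : ℝ) : ‖(x : Circle1)‖ ≤ |x| := by
  rw [AddCircle.norm_eq]
  simpa using round_le x 0

theorem floor_mem_Icc_of_abs_le {x T : ℝ} (hx : |x| ≤ T) : ⌊x⌋ ∈ Finset.Icc ⌊-T⌋ ⌊T⌋ :=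
  Finset.mem_Icc.2 ⟨Int.floor_mono (abs_le.1 hx).1, Int.floor_mono (abs_le.1 hx).2⟩

theorem card_Icc_floor_le {T : ℝ} (hT : 1 ≤ T) : ((Finset.Icc ⌊-T⌋ ⌊T⌋).card : ℝ) ≤ 4 * T := by
  rw [Int.card_Icc]
  have h1 := Int.floor_le T
  have h2 := Int.lt_floor_add_one (-T)
  have h3 : (0 : ℤ) ≤ ⌊T⌋ + 1 - ⌊-T⌋ := by
    have : ⌊-T⌋ ≤ ⌊T⌋ := Int.floor_mono (by linarith)
    linarith
  have h4 : (((⌊T⌋ + 1 - ⌊-T⌋).toNat : ℤ) : ℝ) = ((⌊T⌋ + 1 - ⌊-T⌋ : ℤ) : ℝ) := by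
    rw [Int.toNat_of_nonneg h3]
  push_cast at h4
  rw [h4]
  linarith

namespace IsInvariantSection

variable {α : ℝ} {A : Matrix.GeneralLinearGroup (Fin 2) ℤ} {h : C(Circle1, Torus2)}
  {g : ℝ → Torus2} {c : Torus2} {e : (Fin 2 → ℝ) ≃L[ℝ] (Fin 2 → ℝ)} {l : Fin 2 → ℝ} {m : ℕ}

/-- Integer shifts change `g` by translations, which are isometries. This reduces the claim to a
compact interval containing `[0, 1)` and its unit neighbourhood. -/
theorem uniformContinuous (hg : IsInvariantSection α A h g c) : UniformContinuous g := by
  rw [Metric.uniformContinuous_iff]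
  intro ε hε
  have h1 := (isCompact_Icc (a := (-1 : ℝ)) (b := 2)).uniformContinuousOn_of_continuous
    hg.continuous.continuousOn
  obtain ⟨δ, hδ, h2⟩ := Metric.uniformContinuousOn_iff.1 h1 ε hε
  refine ⟨min δ 1, lt_min hδ one_pos, fun {s t} hst => ?_⟩
  obtain ⟨hst1, hst2⟩ := lt_min_iff.1 hst
  have h3 := Int.floor_le s
  have h4 := Int.lt_floor_add_one s
  have h5 := abs_lt.1 ((Real.dist_eq s t).symm.trans_lt hst2)
  have h6 := h2 (s - ⌊s⌋) ⟨by linarith, by linarith⟩ (t - ⌊s⌋) ⟨by linarith [h5.2], by linarith [h5.1]⟩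
    (by rwa [dist_sub_right])
  have h7 := hg.map_add_intCast (s - ⌊s⌋) ⌊s⌋
  have h8 := hg.map_add_intCast (t - ⌊s⌋) ⌊s⌋
  rw [sub_add_cancel] at h7 h8
  rwa [h7, h8, dist_add_right]

/-- Every point of the phase space has bounded coordinates relative to an invariant section. -/
theorem exists_coordinates (g : ℝ → Torus2) (p : Circle1 × Torus2) : ∃ y : ℝ × (Fin 2 → ℝ),
    |y.1| ≤ 1 ∧ ‖y.2‖ ≤ 1 ∧ p = ((y.1 : Circle1), g y.1 + toTorus y.2) := by
  obtain ⟨s, hs⟩ := QuotientAddGroup.mk_surjective p.1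
  have hs' : ((Int.fract s : ℝ) : Circle1) = p.1 := by
    rw [← hs, ← sub_eq_zero]
    exact (AddCircle.coe_eq_zero_iff (1 : ℝ) (x := Int.fract s - s)).2 ⟨-⌊s⌋, by
      rw [zsmul_eq_mul, mul_one, Int.cast_neg]; linarith [Int.self_sub_floor s]⟩
  obtain ⟨x, hx, hxn⟩ := exists_toTorus_eq_norm_eq (p.2 - g (Int.fract s))
  refine ⟨(Int.fract s, x), ?_, hxn.trans ?_, ?_⟩
  · rw [abs_of_nonneg (Int.fract_nonneg s)]
    exact (Int.fract_lt_one s).le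
  · refine (pi_norm_le_iff_of_nonneg zero_le_one).2 fun i => ?_
    refine (AddCircle.norm_le_half_period (1 : ℝ) one_ne_zero).trans ?_
    norm_num
  · simp only [hx, add_sub_cancel]
    exact Prod.ext hs'.symm rfl

/-- Points are coded by boxes of side `δ` in the base and contracting coordinates and `δ / |l 0| ^
n` in the expanding one. Two points with the same code stay `ε`-close for times below `n`, and the
number of codes is of order `|l 0| ^ n`. -/
theorem topEntropy_le (hg : IsInvariantSection α A h g c) (he : IsEigencoords A e l) :
    topEntropy (forcedAffineMap α A h) ≤ (Real.log |l 0| : EReal) := by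
  have hl0 : 0 < |l 0| := zero_lt_one.trans he.expanding
  rw [topEntropy, Dynamics.coverEntropy_eq_iSup_basis Metric.uniformity_basis_dist]
  refine iSup₂_le fun ε hε => ?_
  obtain ⟨δ₁, hδ₁, hgδ⟩ := Metric.uniformContinuous_iff.1 hg.uniformContinuous (ε / 2) (half_pos hε)
  obtain ⟨K, hK0, hK⟩ : ∃ K : ℝ, 0 < K ∧ ∀ x, ‖x‖ ≤ K * ‖e x‖ := by
    refine ⟨‖(e.symm : (Fin 2 → ℝ) →L[ℝ] (Fin 2 → ℝ))‖ + 1, by positivity, fun x => ?_⟩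
    have h1 := (e.symm : (Fin 2 → ℝ) →L[ℝ] (Fin 2 → ℝ)).le_opNorm (e x)
    rw [ContinuousLinearEquiv.coe_coe, e.symm_apply_apply] at h1
    nlinarith [norm_nonneg (e x)]
  obtain ⟨B, hB⟩ : ∃ B : ℝ, ∀ x, ‖x‖ ≤ 1 → ∀ i, |e x i| ≤ B := by
    refine ⟨‖(e : (Fin 2 → ℝ) →L[ℝ] (Fin 2 → ℝ))‖, fun x hx i => ?_⟩
    refine (norm_le_pi_norm (e x) i).trans ?_
    exact (e : (Fin 2 → ℝ) →L[ℝ] (Fin 2 → ℝ)).unit_le_opNorm x hx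
  -- The three bounds control, in turn, the variation of `g`, the base distance, and the fibre
  -- distance measured through `e`.
  obtain ⟨δ, hδ, hδ1, hδ2, hδ3⟩ : ∃ δ : ℝ, 0 < δ ∧ δ ≤ δ₁ ∧ δ ≤ ε ∧ K * δ ≤ ε / 2 := by
    refine ⟨min (min δ₁ ε) (ε / 2 / K), by positivity, (min_le_left _ _).trans (min_le_left _ _),
      (min_le_left _ _).trans (min_le_right _ _), ?_⟩
    calc _ ≤ K * (ε / 2 / K) := mul_le_mul_of_nonneg_left (min_le_right _ _) hK0.le
      _ = _ := mul_div_cancel₀ _ hK0.ne'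
  obtain ⟨N, hN1, hN2, hN3⟩ : ∃ N : ℝ, 1 ≤ N ∧ 1 / δ ≤ N ∧ B / δ ≤ N :=
    ⟨max 1 (max (1 / δ) (B / δ)), le_max_left _ _, (le_max_left _ _).trans (le_max_right _ _),
      (le_max_right _ _).trans (le_max_right _ _)⟩
  choose y hy1 hy2 hy using exists_coordinates g
  have hclose : ∀ {a b : ℝ}, ⌊a / δ⌋ = ⌊b / δ⌋ → |a - b| < δ := by
    intro a b hab
    have := Int.abs_sub_lt_one_of_floor_eq_floor hab
    rwa [← sub_div, abs_div, abs_of_pos hδ, div_lt_one hδ] at this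
  refine expGrowthSup_le_log_of_le (C := 64 * N ^ 3) hl0 fun n => ?_
  have hln : 1 ≤ |l 0| ^ n := one_le_pow₀ he.expanding.le
  let T : ℝ := N * |l 0| ^ n
  have hT : 1 ≤ T := one_le_mul_of_one_le_of_one_le hN1 hln
  -- The three ranges have at most `4 N`, `4 T` and `4 N` elements, whence the constant `64 * N ^
  -- 3`.
  let S : Finset (ℤ × ℤ × ℤ) := Finset.Icc ⌊-N⌋ ⌊N⌋ ×ˢ Finset.Icc ⌊-T⌋ ⌊T⌋ ×ˢ Finset.Icc ⌊-N⌋ ⌊N⌋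
  have hS : (S.card : ℝ) ≤ 64 * N ^ 3 * |l 0| ^ n := by
    rw [Finset.card_product, Finset.card_product, Nat.cast_mul, Nat.cast_mul]
    have h1 := card_Icc_floor_le hN1
    have h2 := card_Icc_floor_le hT
    calc _ ≤ (4 * N) * ((4 * T) * (4 * N)) :=
          mul_le_mul h1 (mul_le_mul h2 h1 (Nat.cast_nonneg _) (by linarith))
            (mul_nonneg (Nat.cast_nonneg _) (Nat.cast_nonneg _)) (by linarith)
      _ = _ := by ring
  have hcov := coverMincard_le_card_of_code (forcedAffineMap α A h)
    {p : (Circle1 × Torus2) × (Circle1 × Torus2) | dist p.1 p.2 < ε} n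
    (fun p => (⌊(y p).1 / δ⌋, ⌊|l 0| ^ n * e (y p).2 0 / δ⌋, ⌊e (y p).2 1 / δ⌋)) S ?_ ?_
  · calc _ ≤ ((S.card : ℕ∞) : ENNReal) := ENat.toENNReal_mono hcov
      _ = ENNReal.ofReal S.card := by rw [ENNReal.ofReal_natCast]; rfl
      _ ≤ _ := ENNReal.ofReal_le_ofReal hS
  · intro p
    have hdiv : ∀ i, |e (y p).2 i / δ| ≤ N := fun i => by
      rw [abs_div, abs_of_pos hδ]
      exact (div_le_div_of_nonneg_right (hB _ (hy2 p) i) hδ.le).trans hN3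
    refine Finset.mem_product.2 ⟨floor_mem_Icc_of_abs_le ?_, Finset.mem_product.2
      ⟨floor_mem_Icc_of_abs_le ?_, floor_mem_Icc_of_abs_le (hdiv 1)⟩⟩
    · rw [abs_div, abs_of_pos hδ]
      exact (div_le_div_of_nonneg_right (hy1 p) hδ.le).trans hN2
    · rw [mul_div_assoc, abs_mul, abs_pow, abs_abs, mul_comm]
      exact mul_le_mul_of_nonneg_right (hdiv 0) (by positivity)
  · intro p p' hpp
    obtain ⟨h1, h23⟩ := Prod.mk.inj hpp
    obtain ⟨h2, h3⟩ := Prod.mk.inj h23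
    replace h1 := hclose h1
    replace h2 := hclose h2
    replace h3 := hclose h3
    refine Dynamics.mem_dynEntourage.2 fun k hk => ?_
    rw [Set.mem_ofPred_eq, hy p, hy p', hg.iterate_forcedAffineMap, hg.iterate_forcedAffineMap,
      iterate_toralAction_toTorus, iterate_toralAction_toTorus]
    refine max_lt ?_ ?_
    · simp only
      rw [dist_eq_norm, ← AddCircle.coe_sub, add_sub_add_right_eq_sub]
      exact (norm_coe_circle_le _).trans_lt (h1.trans_le hδ2)
    · simp only
      have h4 : dist (g ((y p).1 + k * α)) (g ((y p').1 + k * α)) < ε / 2 := by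
        apply hgδ
        rw [dist_add_right, Real.dist_eq]
        exact h1.trans_le hδ1
      have h5 : dist (toTorus ((realMatrix A ^ k) *ᵥ (y p).2))
          (toTorus ((realMatrix A ^ k) *ᵥ (y p').2)) ≤ ε / 2 := by
        rw [dist_eq_norm, ← map_sub, ← Matrix.mulVec_sub]
        refine (norm_toTorus_le _).trans ((hK _).trans (le_trans ?_ hδ3))
        refine mul_le_mul_of_nonneg_left ((pi_norm_le_iff_of_nonneg hδ.le).2 fun i => ?_) hK0.le
        rw [he.map_pow_mulVec, Real.norm_eq_abs, abs_mul, abs_pow, map_sub, Pi.sub_apply]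
        fin_cases i
        · rw [← mul_sub, abs_mul, abs_pow, abs_abs] at h2
          refine le_trans ?_ h2.le
          exact mul_le_mul_of_nonneg_right (pow_le_pow_right₀ he.expanding.le hk.le) (abs_nonneg _)
        · refine le_trans ?_ h3.le
          exact mul_le_of_le_one_left (abs_nonneg _)
            (pow_le_one₀ (abs_nonneg _) he.contracting.le)
      exact (dist_add_add_le _ _ _ _).trans_lt (by linarith)

end IsInvariantSection

/-! ### The main theorem. -/

theorem theorem1p1 (α : ℝ) (hα : Irrational α)
    (A : Matrix.GeneralLinearGroup (Fin 2) ℤ) (hA : IsHyperbolicMatrix A)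
    (h : C(Circle1, Torus2)) (m : ℕ)
    (hm : IsLeast {k : ℕ | IsAdmissibleDegree A (degreeVector h) k} m) :
    (invariantTori α (forcedAffineMap α A h) =
        ⋃ n : ℕ, invariantToriUpTo α (forcedAffineMap α A h) n m) ∧
    (∀ n : ℕ, (invariantToriUpTo α (forcedAffineMap α A h) n m).Finite) ∧
    Filter.Tendsto
      (fun n : ℕ => (((1 / (n : ℝ)) *
        Real.log ((invariantToriUpTo α (forcedAffineMap α A h) n m).ncard : ℝ) : ℝ) : EReal))
      Filter.atTop (nhds (topEntropy (forcedAffineMap α A h))) := by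
  obtain ⟨e, l, he⟩ := exists_eigencoords hA
  obtain ⟨g, c, hg, hc⟩ := exists_isInvariantSection (α := α) he hm
  have hm0 : 0 < m := hm.1.1
  refine ⟨?_, hg.finite_invariantToriUpTo he hm0 hc, ?_⟩
  · ext 𝒯
    simp only [invariantTori, invariantToriUpTo, Set.mem_ofPred_eq, Set.mem_iUnion]
    constructor
    · rintro ⟨n, k, hnk⟩
      obtain rfl := ((hg.isInvariantTorus_iff he hm0 hc n k 𝒯).1 hnk).2.1
      exact ⟨n, n, le_rfl, hnk⟩
    · rintro ⟨n, k, -, hk⟩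
      exact ⟨k, m, hk⟩
  · rw [le_antisymm (hg.topEntropy_le he) (hg.le_topEntropy he)]
    refine (continuous_coe_real_ereal.tendsto _).comp ?_
    obtain ⟨a, ha, hlow⟩ := he.exists_mul_le_ncard_periodicSet
    have hmR : (0 : ℝ) < m := Nat.cast_pos.2 hm0
    -- The factor `m` lost in passing from periodic points to tori, and the factor `n` from the
    -- union over periods, are both invisible at exponential scale.
    refine tendsto_log_div_of_bounds (div_pos ha hmR) four_pos
      (zero_lt_one.trans he.expanding) (fun n hn => ?_)
      (hg.ncard_invariantToriUpTo_le he hm0 hc)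
    have h1 : ((periodicSet A n).ncard : ℝ)
        ≤ m * (invariantToriUpTo α (forcedAffineMap α A h) n m).ncard := by
      exact_mod_cast hg.ncard_periodicSet_le_mul he hm0 hc hn
    rw [div_mul_eq_mul_div, div_le_iff₀' hmR]
    exact (hlow n hn).trans h1
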